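/- Consider a deck of $n\ge 2$ cards and the following three Markov chains on the set of its $n!$ orderings; each chain has the uniform distribution as a stationary distribution. (a) The Rudvalis shuffle: at each step, with probability $1/2$ each, move the top card to the bottom of the deck or move it to the second position from the bottom. (b) The shift-or-swap shuffle: at each step, with probability $1/2$ each, move the top card to the bottom or exchange the top two cards. (c) The symmetrized Rudvalis shuffle: at each step, with probability $1/4$ each, move the top card to the bottom, move the bottom card to the top, exchange the top two cards, or do nothing. The total variation distance between probability distributions $P,Q$ on a finite set is $\tfrac12\sum_y|P(y)-Q(y)|$. Put $C=\frac1{8\pi^2}$ for (a), $C=\frac1{2\pi^2}$ for (b), and $C=\frac1{\pi^2}$ for (c). For each of the three shuffles and every fixed $\varepsilon>0$ there is a sequence $\delta_n\to 0$ such that for every $n\ge 2$, every initial ordering of the deck and every integer $t$ with $0\le t\le (1-\delta_n)\,C\,n^3\log n$, the distribution of the ordering of the deck after $t$ steps of the shuffle has total variation distance at least $1-\varepsilon$ from the uniform distribution. -/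

import Mathlib

noncomputable section

/-- The order of a deck of `n` cards: `d i` is the card at position `i`, where position `0` is the
top of the deck and position `n - 1` is the bottom. -/
abbrev Deck (n : ℕ) : Type := Equiv.Perm (Fin n)

namespace Deck

/-- Take the top card and put it at position `k`. The cards that were at positions `1, …, k` each
move up by one position, and the cards below position `k` stay where they are.
(`Fin.cycleRange k` sends `j` to `j + 1` for `j < k`, sends `k` to `0`, and fixes `j > k`; the card
at position `i` after the move is the one that was at position `Fin.cycleRange k i` before.) -/
def topTo {n : ℕ} (k : Fin n) (d : Deck n) : Deck n := d * Fin.cycleRange k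

/-- Move the top card to the bottom of the deck. -/
def topToBottom {n : ℕ} (hn : 2 ≤ n) : Deck n → Deck n := topTo ⟨n - 1, by omega⟩

/-- Move the top card to the second position from the bottom of the deck. -/
def topToSecondFromBottom {n : ℕ} (hn : 2 ≤ n) : Deck n → Deck n := topTo ⟨n - 2, by omega⟩

/-- Move the bottom card to the top of the deck. -/
def bottomToTop {n : ℕ} (hn : 2 ≤ n) (d : Deck n) : Deck n :=
  d * (Fin.cycleRange (⟨n - 1, by omega⟩ : Fin n))⁻¹

/-- Exchange the top two cards. -/
def swapTopTwo {n : ℕ} (hn : 2 ≤ n) (d : Deck n) : Deck n :=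
  d * Equiv.swap (⟨0, by omega⟩ : Fin n) ⟨1, by omega⟩

end Deck

/-- The transition law of the shuffle that applies one of the moves `m 0, …, m (k - 1)`, each with
probability `1 / k`. -/
def randomMove {n k : ℕ} [NeZero k] (m : Fin k → Deck n → Deck n) (d : Deck n) : PMF (Deck n) :=
  (PMF.uniformOfFintype (Fin k)).map fun i => m i d

/-- One step of the Rudvalis shuffle. -/
def rudvalisStep {n : ℕ} (hn : 2 ≤ n) : Deck n → PMF (Deck n) :=
  randomMove ![Deck.topToBottom hn, Deck.topToSecondFromBottom hn]

/-- One step of the shift-or-swap shuffle. -/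
def shiftOrSwapStep {n : ℕ} (hn : 2 ≤ n) : Deck n → PMF (Deck n) :=
  randomMove ![Deck.topToBottom hn, Deck.swapTopTwo hn]

/-- One step of the symmetrized Rudvalis shuffle. -/
def symmetrizedRudvalisStep {n : ℕ} (hn : 2 ≤ n) : Deck n → PMF (Deck n) :=
  randomMove ![Deck.topToBottom hn, Deck.bottomToTop hn, Deck.swapTopTwo hn, id]

/-- The distribution after `t` steps of the Markov chain with transition law `step`, started from
the state `x`. -/
def lawAfter {α : Type*} (step : α → PMF α) (x : α) : ℕ → PMF α
  | 0 => PMF.pure x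
  | t + 1 => (lawAfter step x t).bind step

/-- The total variation distance of two probability distributions on a finite set. -/
def tvDist {α : Type*} [Fintype α] (P Q : PMF α) : ℝ :=
  (1 / 2) * ∑ y, |(P y).toReal - (Q y).toReal|

end

/-!
The proof is the second moment method of Wilson. Let `Φ` be a complex function on the orderings of
the deck, let the move `m j` carry a weight `w j` of modulus `1`, and suppose that the average of
`w j * Φ (m j d)` over `j` is `l * Φ d`. The product of `Φ` with the accumulated weight is then, up
to the factor `l ^ t`, a martingale along the chain. If its values after the possible moves from a
given state always lie within `B` of a common point, its variance stays below
`B ^ 2 / (1 - ‖l‖ ^ 2)`, and the same bound holds for the second moment of `Φ` under the uniform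
distribution. The weights have modulus `1`, so `‖Φ‖` does not see them; it is a statistic of the
deck alone which separates the law at time `t` from uniform as long as `‖l‖ ^ t * ‖Φ x‖` is large
compared with `B / √(1 - ‖l‖ ^ 2)` (`le_tvDist_of_eigenfunction`).

The function `Φ` is a sum over the cards of a function `g` of the position of the card, with
coefficients conjugate to the values of `g` at the initial positions, so that `Φ x` is of order `n`.
In the frame that rotates with the shifts, a card sits still except near the place where two cards
can be exchanged, and `g` is close to the character `p ↦ exp (2 π i p / n)` or its conjugate. The
rotation is a factor of modulus `1` that the eigenvalue absorbs in the Rudvalis shuffle, where every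
move shifts the deck, and that the weights undo in the other two. Then `B` is of order `1 / n`, and
when `1 - ‖l‖ ~ s / n ^ 3` the law at time `t` is far from uniform until `t` is about
`n ^ 3 * log n / (2 * s)` (`exists_le_tvDist_of_positionEigenfunction`).

What remains is one eigenvalue problem for the motion of a single card in each shuffle, to be solved
with `s = 4 π ^ 2`, `π ^ 2` and `π ^ 2 / 2` respectively. For the first two shuffles `g` is
essentially a geometric sequence; for the third one it solves a second order recurrence with a
defect at the top of the deck. In each case all but one of the real unknowns can be eliminated in
closed form. The last one is written `1 - c / n ^ 3` or `√(c / n ^ 3)`, with `c` in a fixed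
interval, and the difference of the two sides of the remaining equation, suitably scaled, converges
for fixed `c` to a limit that changes sign at the right value of `c`. The intermediate value theorem
then gives exact eigenvalues with the right asymptotics (`eventually_exists_rudvalis_eigenfunction`,
`eventually_exists_shiftOrSwap_eigenfunction`,
`eventually_exists_symmetrizedRudvalis_eigenfunction`).
-/

/-! ### Total variation and expectations -/

section Expectation

variable {α : Type*} [Fintype α]

theorem sum_toReal_pmf (P : PMF α) : ∑ y, (P y).toReal = 1 := by
  rw [← ENNReal.toReal_sum fun y _ => P.apply_ne_top y, ← tsum_fintype (L := .unconditional _),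
    P.tsum_coe, ENNReal.toReal_one]

/-- A test function with values in `[0, 1]` bounds the total variation distance from below. -/
theorem sub_le_tvDist (P Q : PMF α) (f : α → ℝ) (h0 : ∀ y, 0 ≤ f y) (h1 : ∀ y, f y ≤ 1) :
    ∑ y, (Q y).toReal * f y - ∑ y, (P y).toReal * f y ≤ tvDist P Q := by
  have key : ∑ y, (2 * f y - 1) * ((Q y).toReal - (P y).toReal)
      ≤ ∑ y, |(P y).toReal - (Q y).toReal| := by
    refine Finset.sum_le_sum fun y _ => ?_
    rw [abs_sub_comm]
    refine (le_abs_self _).trans ?_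
    rw [abs_mul]
    refine mul_le_of_le_one_left (abs_nonneg _) (abs_le.2 ⟨?_, ?_⟩)
    · linarith [h0 y]
    · linarith [h1 y]
  have expand : ∑ y, (2 * f y - 1) * ((Q y).toReal - (P y).toReal)
      = 2 * (∑ y, (Q y).toReal * f y - ∑ y, (P y).toReal * f y)
        - (∑ y, (Q y).toReal - ∑ y, (P y).toReal) := by
    simp only [← Finset.sum_sub_distrib, Finset.mul_sum]
    exact Finset.sum_congr rfl fun y _ => by ring
  rw [expand, sum_toReal_pmf, sum_toReal_pmf] at key
  unfold tvDist
  linarith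

theorem sum_toReal_bind (P : PMF α) (κ : α → PMF α) (f : α → ℝ) :
    ∑ y, ((P.bind κ) y).toReal * f y
      = ∑ x, (P x).toReal * ∑ y, (κ x y).toReal * f y := by
  have h : ∀ y, ((P.bind κ) y).toReal = ∑ x, (P x).toReal * (κ x y).toReal := by
    intro y
    rw [PMF.bind_apply, tsum_fintype, ENNReal.toReal_sum]
    · simp only [ENNReal.toReal_mul]
    · exact fun x _ => ENNReal.mul_ne_top (P.apply_ne_top x) ((κ x).apply_ne_top y)
  simp only [h, Finset.sum_mul, Finset.mul_sum]
  rw [Finset.sum_comm]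
  exact Finset.sum_congr rfl fun x _ => Finset.sum_congr rfl fun y _ => by ring

end Expectation

section Twisted

variable {n k : ℕ}

/-! ### The second moment method with a twisted eigenfunction -/

/-- One step of the averaging operator of the chain that applies a uniformly chosen move `m j`,
lifted to decks with a phase in the unit circle: the move `m j` multiplies the phase by `w j`. -/
noncomputable def twistedAverage (m : Fin k → Deck n → Deck n) (w : Fin k → Circle)
    (F : Deck n × Circle → ℝ) (p : Deck n × Circle) : ℝ :=
  (k : ℝ)⁻¹ * ∑ j, F (m j p.1, w j * p.2)

theorem twistedAverage_mono (m : Fin k → Deck n → Deck n) (w : Fin k → Circle) :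
    Monotone (twistedAverage m w) := fun F G h p => by
  unfold twistedAverage
  gcongr
  exact h _

variable [NeZero k]

theorem sum_toReal_randomMove (m : Fin k → Deck n → Deck n) (d : Deck n) (f : Deck n → ℝ) :
    ∑ y, (randomMove m d y).toReal * f y = (k : ℝ)⁻¹ * ∑ j, f (m j d) := by
  have h : ∀ y, (randomMove m d y).toReal = ∑ j, if y = m j d then (k : ℝ)⁻¹ else 0 := by
    intro y
    rw [randomMove, PMF.map_apply, tsum_fintype, ENNReal.toReal_sum]
    · refine Finset.sum_congr rfl fun j _ => ?_
      split_ifs <;> simp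
    · intro j _
      split_ifs <;> simp [NeZero.ne k]
  simp only [h, Finset.sum_mul, Finset.mul_sum]
  rw [Finset.sum_comm]
  refine Finset.sum_congr rfl fun j _ => ?_
  simp [ite_mul]

theorem twistedAverage_add_const (m : Fin k → Deck n → Deck n) (w : Fin k → Circle)
    (F : Deck n × Circle → ℝ) (a b : ℝ) :
    twistedAverage m w (fun p => a * F p + b) = fun p => a * twistedAverage m w F p + b := by
  funext p
  have hk : (k : ℝ) ≠ 0 := Nat.cast_ne_zero.2 (NeZero.ne k)
  simp only [twistedAverage, Finset.sum_add_distrib, ← Finset.mul_sum, Finset.sum_const,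
    Finset.card_univ, Fintype.card_fin, nsmul_eq_mul]
  field_simp

/-- Forgetting the phase, the iterated averaging operator computes expectations of the chain. -/
theorem iterate_twistedAverage_comp_fst (m : Fin k → Deck n → Deck n) (w : Fin k → Circle)
    (x : Deck n) (c : Circle) (t : ℕ) (f : Deck n → ℝ) :
    (twistedAverage m w)^[t] (fun p => f p.1) (x, c)
      = ∑ y, (lawAfter (randomMove m) x t y).toReal * f y := by
  induction t generalizing f with
  | zero => simp [lawAfter, PMF.pure_apply, apply_ite ENNReal.toReal]
  | succ t ih =>
    rw [Function.iterate_succ_apply, lawAfter, sum_toReal_bind]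
    simp only [sum_toReal_randomMove]
    exact ih fun d => (k : ℝ)⁻¹ * ∑ j, f (m j d)

/-- The parallel axis theorem for a uniform average of complex numbers. -/
theorem average_norm_sub_sq (z : Fin k → ℂ) (μ v : ℂ) (hμ : (k : ℂ)⁻¹ * ∑ j, z j = μ) :
    (k : ℝ)⁻¹ * ∑ j, ‖z j - v‖ ^ 2
      = ‖μ - v‖ ^ 2 + (k : ℝ)⁻¹ * ∑ j, ‖z j - μ‖ ^ 2 := by
  have hk : (k : ℝ) ≠ 0 := Nat.cast_ne_zero.2 (NeZero.ne k)
  have hkc : (k : ℂ) ≠ 0 := Nat.cast_ne_zero.2 (NeZero.ne k)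
  have hsum : ∑ j, (z j - μ) = 0 := by
    rw [Finset.sum_sub_distrib, ← hμ]
    simp [hkc]
  have h : ∀ j, ‖z j - v‖ ^ 2
      = ‖μ - v‖ ^ 2 + ‖z j - μ‖ ^ 2 + 2 * inner ℝ (μ - v) (z j - μ) := by
    intro j
    rw [show z j - v = (μ - v) + (z j - μ) by ring, norm_add_sq_real]
    ring
  simp only [h, Finset.sum_add_distrib, ← Finset.mul_sum, ← inner_sum, hsum, inner_zero_right]
  simp
  field_simp

variable {m : Fin k → Deck n → Deck n} {w : Fin k → Circle} {Φ : Deck n → ℂ} {l : ℂ} {B : ℝ}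

/-- If all the values `w j * Φ (m j d)` lie within `B` of a common point, then the second moment
about any point `v` exceeds that of their mean `l * Φ d` by at most `B ^ 2`. -/
theorem average_norm_sub_sq_le
    (heig : ∀ d, (k : ℂ)⁻¹ * ∑ j, (w j : ℂ) * Φ (m j d) = l * Φ d)
    (hB : ∀ d, ∃ a, ∀ j, ‖(w j : ℂ) * Φ (m j d) - a‖ ≤ B) (d : Deck n) (v : ℂ) :
    (k : ℝ)⁻¹ * ∑ j, ‖(w j : ℂ) * Φ (m j d) - v‖ ^ 2 ≤ ‖l * Φ d - v‖ ^ 2 + B ^ 2 := by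
  have hk : (0 : ℝ) < k := Nat.cast_pos.2 (NeZero.pos k)
  rw [average_norm_sub_sq _ _ v (heig d)]
  obtain ⟨a, ha⟩ := hB d
  have h1 := average_norm_sub_sq _ _ a (heig d)
  have h2 : (k : ℝ)⁻¹ * ∑ j, ‖(w j : ℂ) * Φ (m j d) - a‖ ^ 2 ≤ B ^ 2 := by
    have : ∑ j, ‖(w j : ℂ) * Φ (m j d) - a‖ ^ 2 ≤ ∑ _j : Fin k, B ^ 2 :=
      Finset.sum_le_sum fun j _ => pow_le_pow_left₀ (norm_nonneg _) (ha j) 2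
    rw [Finset.sum_const, Finset.card_univ, Fintype.card_fin, nsmul_eq_mul] at this
    rwa [inv_mul_le_iff₀ hk]
  have h3 : 0 ≤ ‖l * Φ d - a‖ ^ 2 := by positivity
  linarith

/-- The twisted eigenfunction, followed along the lifted chain, has variance at most
`B ^ 2 / (1 - ‖l‖ ^ 2)` at every time. -/
theorem iterate_twistedAverage_le
    (heig : ∀ d, (k : ℂ)⁻¹ * ∑ j, (w j : ℂ) * Φ (m j d) = l * Φ d)
    (hB : ∀ d, ∃ a, ∀ j, ‖(w j : ℂ) * Φ (m j d) - a‖ ≤ B) (hl : ‖l‖ < 1) (t : ℕ) (u : ℂ)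
    (p : Deck n × Circle) :
    (twistedAverage m w)^[t] (fun p => ‖(p.2 : ℂ) * Φ p.1 - l ^ t * u‖ ^ 2) p
      ≤ (‖l‖ ^ 2) ^ t * ‖(p.2 : ℂ) * Φ p.1 - u‖ ^ 2
        + B ^ 2 / (1 - ‖l‖ ^ 2) * (1 - (‖l‖ ^ 2) ^ t) := by
  have hl2 : 0 < 1 - ‖l‖ ^ 2 := by nlinarith [norm_nonneg l]
  induction t generalizing u p with
  | zero => simp
  | succ t ih =>
    have hstep : ∀ q : Deck n × Circle,
        twistedAverage m w (fun p => ‖(p.2 : ℂ) * Φ p.1 - l * u‖ ^ 2) q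
          ≤ ‖l‖ ^ 2 * ‖(q.2 : ℂ) * Φ q.1 - u‖ ^ 2 + B ^ 2 := by
      intro q
      have hc : (q.2 : ℂ) ≠ 0 := Circle.coe_ne_zero _
      have h := average_norm_sub_sq_le heig hB q.1 ((q.2 : ℂ)⁻¹ * (l * u))
      have hrot : ∀ z : ℂ, ‖z - (q.2 : ℂ)⁻¹ * (l * u)‖ = ‖(q.2 : ℂ) * z - l * u‖ := by
        intro z
        have : (q.2 : ℂ) * z - l * u = (q.2 : ℂ) * (z - (q.2 : ℂ)⁻¹ * (l * u)) := by
          field_simp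
        rw [this, norm_mul, Circle.norm_coe, one_mul]
      simp only [hrot] at h
      have e1 : (q.2 : ℂ) * (l * Φ q.1) - l * u = l * ((q.2 : ℂ) * Φ q.1 - u) := by ring
      rw [e1, norm_mul, mul_pow] at h
      simp only [twistedAverage, Circle.coe_mul]
      convert h using 6
      ring_nf
    have hmono := twistedAverage_mono m w (fun q => ih (l * u) q) p
    rw [twistedAverage_add_const] at hmono
    rw [Function.iterate_succ_apply', pow_succ l, mul_assoc]
    refine hmono.trans ?_
    have hs := mul_le_mul_of_nonneg_left (hstep p) (by positivity : 0 ≤ (‖l‖ ^ 2) ^ t)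
    have e2 : B ^ 2 / (1 - ‖l‖ ^ 2) * (1 - (‖l‖ ^ 2) ^ (t + 1))
        = B ^ 2 / (1 - ‖l‖ ^ 2) * (1 - (‖l‖ ^ 2) ^ t) + (‖l‖ ^ 2) ^ t * B ^ 2 := by
      field_simp
      ring
    rw [e2, pow_succ (‖l‖ ^ 2)]
    simp only
    linarith

/-- The second moment of an eigenfunction under the uniform distribution, which is stationary
because the moves are bijections. -/
theorem sum_uniform_norm_sq_le (hm : ∀ j, Function.Bijective (m j))
    (heig : ∀ d, (k : ℂ)⁻¹ * ∑ j, (w j : ℂ) * Φ (m j d) = l * Φ d)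
    (hB : ∀ d, ∃ a, ∀ j, ‖(w j : ℂ) * Φ (m j d) - a‖ ≤ B) (hl : ‖l‖ < 1) :
    ∑ d, (PMF.uniformOfFintype (Deck n) d).toReal * ‖Φ d‖ ^ 2 ≤ B ^ 2 / (1 - ‖l‖ ^ 2) := by
  have hk : (k : ℝ) ≠ 0 := Nat.cast_ne_zero.2 (NeZero.ne k)
  have hl2 : 0 < 1 - ‖l‖ ^ 2 := by nlinarith [norm_nonneg l]
  have hN : (0 : ℝ) < Fintype.card (Deck n) := Nat.cast_pos.2 Fintype.card_pos
  have hstep : ∀ d, (k : ℝ)⁻¹ * ∑ j, ‖Φ (m j d)‖ ^ 2 ≤ ‖l‖ ^ 2 * ‖Φ d‖ ^ 2 + B ^ 2 := by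
    intro d
    have h := average_norm_sub_sq_le heig hB d 0
    simpa only [sub_zero, norm_mul, Circle.norm_coe, one_mul, mul_pow] using h
  have hsum := Finset.sum_le_sum fun d (_ : d ∈ Finset.univ) => hstep d
  have hinv : ∑ d, (k : ℝ)⁻¹ * ∑ j, ‖Φ (m j d)‖ ^ 2 = ∑ d, ‖Φ d‖ ^ 2 := by
    rw [← Finset.mul_sum, Finset.sum_comm]
    have : ∀ j, ∑ d, ‖Φ (m j d)‖ ^ 2 = ∑ d, ‖Φ d‖ ^ 2 := fun j =>
      (hm j).sum_comp fun d => ‖Φ d‖ ^ 2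
    simp only [this, Finset.sum_const, Finset.card_univ, Fintype.card_fin, nsmul_eq_mul]
    field_simp
  rw [hinv, Finset.sum_add_distrib, ← Finset.mul_sum, Finset.sum_const, Finset.card_univ,
    nsmul_eq_mul] at hsum
  have hunif : ∀ d, (PMF.uniformOfFintype (Deck n) d).toReal
      = (Fintype.card (Deck n) : ℝ)⁻¹ := fun d => by
    rw [PMF.uniformOfFintype_apply]
    simp
  simp only [hunif]
  rw [← Finset.mul_sum, inv_mul_le_iff₀ hN, mul_div_assoc', le_div_iff₀ hl2]
  linarith

/-- The second moment lower bound for total variation: the modulus of a twisted eigenfunction is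
typically at most `B / √(1 - ‖l‖ ^ 2)` under the uniform distribution, and after `t` steps it is
typically within that distance of `‖l‖ ^ t * ‖Φ x‖`. -/
theorem le_tvDist_of_eigenfunction (hm : ∀ j, Function.Bijective (m j))
    (heig : ∀ d, (k : ℂ)⁻¹ * ∑ j, (w j : ℂ) * Φ (m j d) = l * Φ d)
    (hB : ∀ d, ∃ a, ∀ j, ‖(w j : ℂ) * Φ (m j d) - a‖ ≤ B) (hl : ‖l‖ < 1) (hl0 : l ≠ 0)
    {x : Deck n} (hx : Φ x ≠ 0) (t : ℕ) :
    1 - 8 * (B ^ 2 / (1 - ‖l‖ ^ 2)) / (‖l‖ ^ t * ‖Φ x‖) ^ 2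
      ≤ tvDist (lawAfter (randomMove m) x t) (PMF.uniformOfFintype (Deck n)) := by
  set V := B ^ 2 / (1 - ‖l‖ ^ 2) with hV
  set v := ‖l‖ ^ t * ‖Φ x‖ with hv
  have hl2 : 0 < 1 - ‖l‖ ^ 2 := by nlinarith [norm_nonneg l]
  have hv0 : 0 < v := by
    have := norm_pos_iff.2 hl0
    have := norm_pos_iff.2 hx
    positivity
  have hV0 : 0 ≤ V := by positivity
  let f : Deck n → ℝ := fun d => if ‖Φ d‖ < v / 2 then 1 else 0
  have hf0 : ∀ d, 0 ≤ f d := fun d => by simp only [f]; split_ifs <;> norm_num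
  have hf1 : ∀ d, f d ≤ 1 := fun d => by simp only [f]; split_ifs <;> norm_num
  refine le_trans ?_ (sub_le_tvDist _ _ f hf0 hf1)
  have hunif : 1 - 4 * V / v ^ 2 ≤ ∑ d, (PMF.uniformOfFintype (Deck n) d).toReal * f d := by
    have hpt : ∀ d, 1 - 4 / v ^ 2 * ‖Φ d‖ ^ 2 ≤ f d := by
      intro d
      simp only [f]
      split_ifs with h
      · have : 0 ≤ 4 / v ^ 2 * ‖Φ d‖ ^ 2 := by positivity
        linarith
      · have h2 : (v / 2) ^ 2 ≤ ‖Φ d‖ ^ 2 := pow_le_pow_left₀ (by positivity) (not_lt.1 h) 2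
        rw [sub_nonpos, div_mul_eq_mul_div, le_div_iff₀ (by positivity)]
        linarith
    have h1 := sum_uniform_norm_sq_le hm heig hB hl
    have h2 := Finset.sum_le_sum fun d (_ : d ∈ Finset.univ) =>
      mul_le_mul_of_nonneg_left (hpt d)
        (ENNReal.toReal_nonneg (a := PMF.uniformOfFintype (Deck n) d))
    have h3 : ∑ d, (PMF.uniformOfFintype (Deck n) d).toReal * (1 - 4 / v ^ 2 * ‖Φ d‖ ^ 2)
        = 1 - 4 / v ^ 2 * ∑ d, (PMF.uniformOfFintype (Deck n) d).toReal * ‖Φ d‖ ^ 2 := by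
      simp only [mul_sub, mul_one, Finset.sum_sub_distrib, sum_toReal_pmf, Finset.mul_sum]
      exact congrArg _ (Finset.sum_congr rfl fun d _ => by ring)
    rw [h3] at h2
    have h4 := mul_le_mul_of_nonneg_left h1 (by positivity : 0 ≤ 4 / v ^ 2)
    refine le_trans ?_ h2
    rw [← hV] at h4
    rw [mul_div_right_comm]
    linarith
  have hlaw : ∑ d, (lawAfter (randomMove m) x t d).toReal * f d ≤ 4 * V / v ^ 2 := by
    rw [← iterate_twistedAverage_comp_fst m w x 1 t f]
    have hpt : (fun p : Deck n × Circle => f p.1) ≤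
        fun p => 4 / v ^ 2 * ‖(p.2 : ℂ) * Φ p.1 - l ^ t * Φ x‖ ^ 2 + 0 := by
      intro p
      simp only [f]
      split_ifs with h
      · have h1 : v / 2 ≤ ‖(p.2 : ℂ) * Φ p.1 - l ^ t * Φ x‖ := by
          have h2 := norm_sub_norm_le (l ^ t * Φ x) ((p.2 : ℂ) * Φ p.1)
          rw [norm_mul, norm_pow, ← hv, norm_mul, Circle.norm_coe, one_mul, norm_sub_rev] at h2
          linarith
        have h2 := pow_le_pow_left₀ (by positivity) h1 2
        rw [add_zero, div_mul_eq_mul_div, le_div_iff₀ (by positivity)]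
        linarith
      · positivity
    refine ((twistedAverage_mono m w).iterate t hpt (x, 1)).trans ?_
    have hconst : ∀ (F : Deck n × Circle → ℝ) (a : ℝ) (t : ℕ),
        (twistedAverage m w)^[t] (fun p => a * F p + 0)
          = fun p => a * (twistedAverage m w)^[t] F p + 0 := by
      intro F a t
      induction t with
      | zero => rfl
      | succ t ih =>
        rw [Function.iterate_succ_apply', ih, twistedAverage_add_const,
          ← Function.iterate_succ_apply' (twistedAverage m w)]
    rw [hconst]
    have h := iterate_twistedAverage_le heig hB hl t (Φ x) (x, 1)
    simp only [Circle.coe_one, one_mul, sub_self, norm_zero, ne_eq, OfNat.ofNat_ne_zero,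
      not_false_eq_true, zero_pow, mul_zero, zero_add] at h
    have hq : 0 ≤ (‖l‖ ^ 2) ^ t := by positivity
    have h' := h.trans (mul_le_of_le_one_right hV0 (by linarith))
    simp only [add_zero]
    calc _ ≤ 4 / v ^ 2 * V := mul_le_mul_of_nonneg_left h' (by positivity)
      _ = 4 * V / v ^ 2 := by ring
  have : 8 * V / v ^ 2 = 4 * V / v ^ 2 + 4 * V / v ^ 2 := by ring
  linarith

end Twisted

/-! ### From one card to the whole deck -/

/-- The function `g` on positions is an eigenfunction, with eigenvalue `l`, of the motion of a
single card when the move with permutation `τ j` (which takes a card from position `p` to position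
`(τ j)⁻¹ p`) carries the weight `w j`. Its modulus lies between `1 / 2` and `K`, and the values
that the different moves give at one position are within `O(K / n ^ 2)` of each other, except at
the positions `0`, `1` and `n - 1`, where they are within `O(K / n)`. -/
structure IsPositionEigenfunction {n k : ℕ} (τ : Fin k → Equiv.Perm (Fin n)) (w : Fin k → Circle)
    (g : Fin n → ℂ) (l : ℂ) (K : ℝ) : Prop where
  eig : ∀ p, (k : ℂ)⁻¹ * ∑ j, (w j : ℂ) * g ((τ j)⁻¹ p) = l * g p
  near : ∃ a : Fin n → ℂ, ∀ j p, ‖(w j : ℂ) * g ((τ j)⁻¹ p) - a p‖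
    ≤ K / n ^ 2 + if p.val ≤ 1 ∨ p.val + 1 = n then K / n else 0
  half_le : ∀ p, 1 / 2 ≤ ‖g p‖
  le_bound : ∀ p, ‖g p‖ ≤ K

theorem sum_exceptional_le (n : ℕ) (hn : n ≠ 0) {K : ℝ} (hK : 0 ≤ K) :
    ∑ p : Fin n, (K / n ^ 2 + if p.val ≤ 1 ∨ p.val + 1 = n then K / n else 0) ≤ 4 * K / n := by
  have hone : ∀ c : ℕ, ∑ p : Fin n, (if p.val = c then K / n else 0) ≤ K / n := by
    intro c
    rw [Fin.sum_univ_eq_sum_range (fun i => if i = c then K / n else 0) n, Finset.sum_ite_eq']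
    split_ifs
    · exact le_rfl
    · positivity
  have hpt : ∀ p : Fin n, (K / n ^ 2 + if p.val ≤ 1 ∨ p.val + 1 = n then K / n else 0)
      ≤ K / n ^ 2 + ((if p.val = 0 then K / n else 0) + ((if p.val = 1 then K / n else 0)
        + if p.val = n - 1 then K / n else 0)) := by
    intro p
    have h0 : 0 ≤ K / n := by positivity
    have hp := p.isLt
    split_ifs <;> first | omega | linarith
  refine (Finset.sum_le_sum fun p _ => hpt p).trans ?_
  simp only [Finset.sum_add_distrib, Finset.sum_const, Finset.card_univ, Fintype.card_fin,
    nsmul_eq_mul]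
  have h0 := hone 0
  have h1 := hone 1
  have h2 := hone (n - 1)
  have hn' : (n : ℝ) ≠ 0 := Nat.cast_ne_zero.2 hn
  have e : (n : ℝ) * (K / n ^ 2) = K / n := by field_simp
  have e4 : 4 * K / n = K / n + (K / n + (K / n + K / n)) := by ring
  rw [e, e4]
  linarith

/-- Summing a position eigenfunction over all the cards, with coefficients conjugate to its values
at the initial positions, gives an eigenfunction of the whole deck that is of order `n` at the
start and that one step moves by `O(1 / n)`. -/
theorem IsPositionEigenfunction.le_tvDist {n k : ℕ} [NeZero k] {τ : Fin k → Equiv.Perm (Fin n)}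
    {w : Fin k → Circle} {g : Fin n → ℂ} {l : ℂ} {K : ℝ} (hn : n ≠ 0)
    (h : IsPositionEigenfunction τ w g l K) (hl : ‖l‖ < 1) (hl0 : l ≠ 0) (x : Deck n) (t : ℕ) :
    1 - 8 * ((4 * K ^ 2 / n) ^ 2 / (1 - ‖l‖ ^ 2)) / (‖l‖ ^ t * (n / 4)) ^ 2
      ≤ tvDist (lawAfter (randomMove fun j d => d * τ j) x t) (PMF.uniformOfFintype (Deck n)) := by
  have hnpos : (0 : ℝ) < n := Nat.cast_pos.2 (Nat.pos_of_ne_zero hn)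
  have hK : 0 ≤ K := (norm_nonneg _).trans (h.le_bound ⟨0, Nat.pos_of_ne_zero hn⟩)
  let c : Fin n → ℂ := fun i => (starRingEnd ℂ) (g (x⁻¹ i))
  let Φ : Deck n → ℂ := fun d => ∑ p, c (d p) * g p
  have hmove : ∀ (j : Fin k) (d : Deck n), Φ (d * τ j) = ∑ p, c (d p) * g ((τ j)⁻¹ p) := by
    intro j d
    simp only [Φ]
    rw [← Equiv.sum_comp (τ j) fun p => c (d p) * g ((τ j)⁻¹ p)]
    exact Finset.sum_congr rfl fun p _ => by simp
  have heig : ∀ d, (k : ℂ)⁻¹ * ∑ j, (w j : ℂ) * Φ (d * τ j) = l * Φ d := by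
    intro d
    simp only [hmove, Finset.mul_sum]
    rw [Finset.sum_comm]
    simp only [Φ, Finset.mul_sum]
    refine Finset.sum_congr rfl fun p _ => ?_
    have := h.eig p
    rw [Finset.mul_sum] at this
    rw [mul_left_comm, ← this, Finset.mul_sum]
    exact Finset.sum_congr rfl fun j _ => by ring
  have hB : ∀ d, ∃ a, ∀ j, ‖(w j : ℂ) * Φ (d * τ j) - a‖ ≤ 4 * K ^ 2 / n := by
    intro d
    obtain ⟨a, ha⟩ := h.near
    refine ⟨∑ p, c (d p) * a p, fun j => ?_⟩
    have e : (w j : ℂ) * Φ (d * τ j) - ∑ p, c (d p) * a p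
        = ∑ p, c (d p) * ((w j : ℂ) * g ((τ j)⁻¹ p) - a p) := by
      rw [hmove, Finset.mul_sum, ← Finset.sum_sub_distrib]
      exact Finset.sum_congr rfl fun p _ => by ring
    rw [e]
    calc ‖∑ p, c (d p) * ((w j : ℂ) * g ((τ j)⁻¹ p) - a p)‖
        ≤ ∑ p : Fin n, K * (K / n ^ 2 + if p.val ≤ 1 ∨ p.val + 1 = n then K / n else 0) := by
          refine norm_sum_le_of_le _ fun p _ => ?_
          rw [norm_mul]
          refine mul_le_mul ?_ (ha j p) (norm_nonneg _) hK
          simpa [c] using h.le_bound (x⁻¹ (d p))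
      _ ≤ K * (4 * K / n) := by
          rw [← Finset.mul_sum]
          exact mul_le_mul_of_nonneg_left (sum_exceptional_le n hn hK) hK
      _ = 4 * K ^ 2 / n := by ring
  have hΦx : (n : ℝ) / 4 ≤ ‖Φ x‖ := by
    have e : Φ x = ((∑ p, ‖g p‖ ^ 2 : ℝ) : ℂ) := by
      have hc : ∀ p, c (x p) = (starRingEnd ℂ) (g p) := fun p => by simp [c]
      simp only [Φ, hc, Complex.conj_mul']
      push_cast
      rfl
    rw [e, Complex.norm_real, Real.norm_eq_abs]
    refine le_trans ?_ (le_abs_self _)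
    have : ∑ _p : Fin n, (1 / 4 : ℝ) ≤ ∑ p, ‖g p‖ ^ 2 :=
      Finset.sum_le_sum fun p _ => by nlinarith [h.half_le p]
    simpa [div_eq_mul_inv] using this
  have hΦ0 : Φ x ≠ 0 := by
    rw [← norm_pos_iff]
    exact lt_of_lt_of_le (by positivity) hΦx
  have hl2 : 0 < 1 - ‖l‖ ^ 2 := by nlinarith [norm_nonneg l]
  have hlpos := norm_pos_iff.2 hl0
  refine le_trans ?_ (le_tvDist_of_eigenfunction (m := fun j d => d * τ j) (w := w) (Φ := Φ)
    (fun j => Group.mulRight_bijective (τ j)) heig hB hl hl0 hΦ0 t)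
  gcongr

/-! ### From eigenvalues to mixing times -/

/-- If a bound holds for all large `n` as soon as `δ > 0` is fixed, and becomes weaker as `δ` grows,
then it holds along some sequence `δ n → 0`. -/
theorem exists_tendsto_zero_of_eventually {P : ℝ → ℕ → Prop}
    (hmono : ∀ a b n, a ≤ b → P a n → P b n) (htriv : ∀ n, P 2 n)
    (hev : ∀ δ, 0 < δ → ∀ᶠ n in Filter.atTop, P δ n) :
    ∃ δ : ℕ → ℝ, Filter.Tendsto δ Filter.atTop (nhds 0) ∧ ∀ n, P (δ n) n := by
  let S : ℕ → Set ℝ := fun n => {δ | 0 ≤ δ ∧ P δ n}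
  have hne : ∀ n, (S n).Nonempty := fun n => ⟨2, by norm_num, htriv n⟩
  have hbdd : ∀ n, BddBelow (S n) := fun n => ⟨0, fun _ h => h.1⟩
  refine ⟨fun n => sInf (S n) + 1 / ((n : ℝ) + 1), ?_, fun n => ?_⟩
  · rw [← add_zero (0 : ℝ)]
    refine Filter.Tendsto.add ?_ tendsto_one_div_add_atTop_nhds_zero_nat
    rw [Metric.tendsto_atTop']
    intro e he
    obtain ⟨N, hN⟩ := Filter.eventually_atTop.1 (hev (e / 2) (by positivity))
    refine ⟨N, fun n hn => ?_⟩
    have h1 : sInf (S n) ≤ e / 2 := csInf_le (hbdd n) ⟨by positivity, hN n hn.le⟩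
    have h0 : 0 ≤ sInf (S n) := le_csInf (hne n) fun _ h => h.1
    rw [Real.dist_eq, sub_zero, abs_of_nonneg h0]
    linarith
  · have hlt : sInf (S n) < sInf (S n) + 1 / ((n : ℝ) + 1) := by
      have : 0 < 1 / ((n : ℝ) + 1) := by positivity
      linarith
    obtain ⟨d, hd, hd'⟩ := exists_lt_of_csInf_lt (hne n) hlt
    exact hmono d _ n hd'.le hd.2

/-- The mixing time lower bound that follows from position eigenfunctions whose eigenvalues `l`
satisfy `1 - ‖l‖ ~ s / n ^ 3`. -/
theorem exists_le_tvDist_of_positionEigenfunction {k : ℕ} [NeZero k]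
    (step : ∀ n : ℕ, 2 ≤ n → Deck n → PMF (Deck n)) {s : ℝ} (hs : 0 < s)
    (H : ∀ η, 0 < η → ∃ K κ : ℝ, 0 < κ ∧ ∀ᶠ n : ℕ in Filter.atTop, ∀ hn : 2 ≤ n,
      ∃ (τ : Fin k → Equiv.Perm (Fin n)) (w : Fin k → Circle) (g : Fin n → ℂ) (l : ℂ),
        step n hn = randomMove (fun j d => d * τ j) ∧ IsPositionEigenfunction τ w g l K ∧
        κ / n ^ 3 ≤ 1 - ‖l‖ ∧ 1 - ‖l‖ ≤ (1 + η) * s / n ^ 3) (ε : ℝ) (hε : 0 < ε) :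
    ∃ δ : ℕ → ℝ, Filter.Tendsto δ Filter.atTop (nhds 0) ∧
      ∀ (n : ℕ) (hn : 2 ≤ n) (x : Deck n) (t : ℕ),
        (t : ℝ) ≤ (1 - δ n) / (2 * s) * (n : ℝ) ^ 3 * Real.log n →
          1 - ε ≤ tvDist (lawAfter (step n hn) x t) (PMF.uniformOfFintype (Deck n)) := by
  have hrange : ∀ n : ℕ, 2 ≤ n → 0 < 1 / (2 * s) * (n : ℝ) ^ 3 * Real.log n := by
    intro n hn
    have h2 : (2 : ℝ) ≤ n := by exact_mod_cast hn
    have := Real.log_pos (by linarith : (1 : ℝ) < n)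
    have : (0 : ℝ) < n := by linarith
    positivity
  refine exists_tendsto_zero_of_eventually (P := fun δ n => ∀ (hn : 2 ≤ n) (x : Deck n) (t : ℕ),
    (t : ℝ) ≤ (1 - δ) / (2 * s) * (n : ℝ) ^ 3 * Real.log n →
      1 - ε ≤ tvDist (lawAfter (step n hn) x t) (PMF.uniformOfFintype (Deck n))) ?_ ?_ ?_
  · intro a b n hab h hn x t ht
    refine h hn x t (ht.trans ?_)
    have := mul_le_mul_of_nonneg_right (by linarith : 1 - b ≤ 1 - a) (hrange n hn).le
    calc _ = (1 - b) * (1 / (2 * s) * (n : ℝ) ^ 3 * Real.log n) := by ring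
      _ ≤ _ := this
      _ = _ := by ring
  · -- For `δ = 2` the range of `t` is empty.
    intro n hn x t ht
    exfalso
    have h1 := hrange n hn
    have h2 : (0 : ℝ) ≤ t := Nat.cast_nonneg t
    have h3 : (1 - 2) / (2 * s) * (n : ℝ) ^ 3 * Real.log n
        = -(1 / (2 * s) * (n : ℝ) ^ 3 * Real.log n) := by ring
    linarith
  · intro δ' hδ'
    obtain ⟨δ, hδ0, hδ1, hδδ'⟩ : ∃ δ : ℝ, 0 < δ ∧ δ < 1 ∧ δ ≤ δ' :=
      ⟨min δ' (1 / 2), by positivity, by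
        have := min_le_right δ' (1 / 2)
        linarith, min_le_left _ _⟩
    obtain ⟨K, κ, hκ, hH⟩ := H (δ / 4) (by positivity)
    have hn3 : Filter.Tendsto (fun n : ℕ => (n : ℝ) ^ 3) Filter.atTop Filter.atTop :=
      (Filter.tendsto_pow_atTop (by norm_num)).comp tendsto_natCast_atTop_atTop
    have hsmall : ∀ᶠ n : ℕ in Filter.atTop,
        (1 + δ / 4) * s / (n : ℝ) ^ 3 < 1 - 1 / (1 + δ / 4) := by
      refine (hn3.const_div_atTop _).eventually (gt_mem_nhds ?_)
      rw [sub_pos, div_lt_one (by positivity)]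
      linarith
    have hpow : ∀ᶠ n : ℕ in Filter.atTop,
        2048 * K ^ 4 / κ * (n : ℝ) ^ (-(δ / 4)) < ε := by
      have h := (tendsto_rpow_neg_atTop (by positivity : 0 < δ / 4)).comp
        (tendsto_natCast_atTop_atTop (R := ℝ))
      have h' := h.const_mul (2048 * K ^ 4 / κ)
      rw [mul_zero] at h'
      exact h'.eventually (gt_mem_nhds hε)
    filter_upwards [hH, hsmall, hpow] with n hHn hsm hpw hn x t ht
    obtain ⟨τ, w, g, l, hstep, hg, hlo, hhi⟩ := hHn hn
    have hn2 : (2 : ℝ) ≤ n := by exact_mod_cast hn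
    have hnpos : (0 : ℝ) < n := by linarith
    have hlog := Real.log_pos (by linarith : (1 : ℝ) < n)
    have hl1 : 1 / (1 + δ / 4) < ‖l‖ := by linarith
    have hlpos : 0 < ‖l‖ := lt_trans (by positivity) hl1
    have hllt : ‖l‖ < 1 := by
      have : 0 < κ / (n : ℝ) ^ 3 := by positivity
      linarith
    have hmain := hg.le_tvDist (by omega) hllt (norm_pos_iff.1 hlpos) x t
    rw [hstep]
    refine le_trans ?_ hmain
    -- the eigenvalue decays slowly enough
    have hlogl : -Real.log ‖l‖ ≤ (1 + δ / 4) ^ 2 * s / (n : ℝ) ^ 3 := by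
      have h1 : -Real.log ‖l‖ ≤ ‖l‖⁻¹ - 1 := by
        rw [← Real.log_inv]
        exact Real.log_le_sub_one_of_pos (by positivity)
      have h2 : ‖l‖⁻¹ - 1 = (1 - ‖l‖) * ‖l‖⁻¹ := by field_simp
      have h3 : ‖l‖⁻¹ ≤ 1 + δ / 4 := by
        rw [inv_le_comm₀ hlpos (by positivity), ← one_div]
        exact hl1.le
      calc -Real.log ‖l‖ ≤ (1 - ‖l‖) * ‖l‖⁻¹ := by rw [← h2]; exact h1
        _ ≤ ((1 + δ / 4) * s / (n : ℝ) ^ 3) * (1 + δ / 4) :=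
            mul_le_mul hhi h3 (by positivity) (by positivity)
        _ = _ := by ring
    have hdecay : (n : ℝ) ^ (-(1 - δ / 4)) ≤ (‖l‖ ^ t) ^ 2 := by
      have e1 : (‖l‖ ^ t) ^ 2 = Real.exp (-(2 * t * -Real.log ‖l‖)) := by
        rw [← pow_mul, ← Real.exp_log hlpos, ← Real.exp_nat_mul, Real.exp_log hlpos]
        push_cast
        congr 1
        ring
      rw [e1, Real.rpow_def_of_pos hnpos]
      refine Real.exp_le_exp.2 ?_
      have ht' : (t : ℝ) ≤ (1 - δ) / (2 * s) * (n : ℝ) ^ 3 * Real.log n := by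
        refine ht.trans ?_
        have := mul_le_mul_of_nonneg_right (by linarith : 1 - δ' ≤ 1 - δ) (hrange n hn).le
        calc _ = (1 - δ') * (1 / (2 * s) * (n : ℝ) ^ 3 * Real.log n) := by ring
          _ ≤ _ := this
          _ = _ := by ring
      have h1 : 2 * (t : ℝ) * -Real.log ‖l‖
          ≤ 2 * ((1 - δ) / (2 * s) * (n : ℝ) ^ 3 * Real.log n)
            * ((1 + δ / 4) ^ 2 * s / (n : ℝ) ^ 3) := by
        have h0 : 0 ≤ -Real.log ‖l‖ := by
          linarith [Real.log_nonpos hlpos.le hllt.le]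
        have hp : 0 ≤ (1 + δ / 4) ^ 2 * s / (n : ℝ) ^ 3 := by positivity
        exact (mul_le_mul_of_nonneg_left hlogl (by positivity)).trans
          (mul_le_mul_of_nonneg_right (by linarith) hp)
      have h2 : 2 * ((1 - δ) / (2 * s) * (n : ℝ) ^ 3 * Real.log n)
            * ((1 + δ / 4) ^ 2 * s / (n : ℝ) ^ 3)
          = (1 - δ) * (1 + δ / 4) ^ 2 * Real.log n := by
        field_simp
      have h3 : (1 - δ) * (1 + δ / 4) ^ 2 ≤ 1 - δ / 4 := by nlinarith [mul_pos hδ0 hδ0]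
      have h4 := mul_le_mul_of_nonneg_right h3 hlog.le
      rw [h2] at h1
      linarith
    have hgap : κ / (n : ℝ) ^ 3 ≤ 1 - ‖l‖ ^ 2 := by nlinarith
    have hbound : 8 * ((4 * K ^ 2 / n) ^ 2 / (1 - ‖l‖ ^ 2)) / (‖l‖ ^ t * (n / 4)) ^ 2
        ≤ 2048 * K ^ 4 / κ * (n : ℝ) ^ (-(δ / 4)) := by
      have hr : 0 < (n : ℝ) ^ (-(1 - δ / 4)) := Real.rpow_pos_of_pos hnpos _
      calc 8 * ((4 * K ^ 2 / n) ^ 2 / (1 - ‖l‖ ^ 2)) / (‖l‖ ^ t * (n / 4)) ^ 2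
          ≤ 8 * ((4 * K ^ 2 / n) ^ 2 / (κ / (n : ℝ) ^ 3))
              / ((n : ℝ) ^ (-(1 - δ / 4)) * (n / 4) ^ 2) := by
            rw [mul_pow]
            gcongr
        _ = 2048 * K ^ 4 / κ * ((n : ℝ) ^ (-(1 - δ / 4)) * n)⁻¹ := by
            field_simp
            ring
        _ = 2048 * K ^ 4 / κ * (n : ℝ) ^ (-(δ / 4)) := by
            have : (n : ℝ) ^ (-(1 - δ / 4)) * n = (n : ℝ) ^ (δ / 4) := by
              rw [← Real.rpow_add_one hnpos.ne']
              congr 1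
              ring
            rw [this, Real.rpow_neg hnpos.le]
    linarith

/-! ### Permutations of positions -/

theorem val_cycleRange {n : ℕ} (k p : Fin n) :
    (Fin.cycleRange k p).val = if p.val < k then p.val + 1 else if p.val = k then 0 else p := by
  rcases lt_trichotomy p k with h | h | h
  · rw [Fin.coe_cycleRange_of_lt h, if_pos (Fin.lt_def.1 h)]
  · subst h
    rw [Fin.coe_cycleRange_of_le le_rfl]
    simp
  · rw [Fin.cycleRange_of_gt h]
    have := Fin.lt_def.1 h
    split_ifs <;> omega

theorem val_cycleRange_inv {n : ℕ} (k p : Fin n) :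
    ((Fin.cycleRange k)⁻¹ p).val
      = if p.val = 0 then k.val else if p.val ≤ k then p.val - 1 else p := by
  obtain ⟨q, rfl⟩ := (Fin.cycleRange k).surjective p
  have h := val_cycleRange k q
  have hk := k.isLt
  rw [Equiv.Perm.inv_def, Equiv.symm_apply_apply]
  generalize (Fin.cycleRange k q).val = v at h ⊢
  split_ifs at h ⊢ <;> omega

theorem val_swap_zero_one {n : ℕ} (hn : 2 ≤ n) (p : Fin n) :
    ((Equiv.swap (⟨0, by omega⟩ : Fin n) ⟨1, by omega⟩) p).val
      = if p.val = 0 then 1 else if p.val = 1 then 0 else p.val := by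
  rw [Equiv.swap_apply_def]
  simp only [Fin.ext_iff]
  split_ifs <;> rfl

/-! ### Limits used to locate the eigenvalues -/

section Limits

open Filter Topology

theorem tendsto_natCast_pow_atTop {k : ℕ} (hk : k ≠ 0) :
    Tendsto (fun n : ℕ => (n : ℝ) ^ k) atTop atTop :=
  (tendsto_pow_atTop hk).comp tendsto_natCast_atTop_atTop

theorem tendsto_mul_sin {a u : ℕ → ℝ} {L : ℝ} (hau : Tendsto (fun n => a n * u n) atTop (𝓝 L))
    (hu : Tendsto u atTop (𝓝 0)) : Tendsto (fun n => a n * Real.sin (u n)) atTop (𝓝 L) := by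
  have h : ∀ x, Real.sin x = x * Real.sinc x := by
    intro x
    rcases eq_or_ne x 0 with rfl | hx
    · simp
    · rw [Real.sinc_of_ne_zero hx]
      field_simp
  have h1 : Tendsto (fun n => Real.sinc (u n)) atTop (𝓝 1) := by
    have := (Real.continuous_sinc.tendsto 0).comp hu
    rwa [Real.sinc_zero] at this
  have h2 := hau.mul h1
  rw [mul_one] at h2
  refine h2.congr fun n => ?_
  rw [h]
  ring

theorem tendsto_div_sub (c : ℝ) (j : ℕ) :
    Tendsto (fun n : ℕ => (n : ℝ) * (c / ((n : ℝ) - j))) atTop (𝓝 c) := by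
  have h1 : Tendsto (fun n : ℕ => (n : ℝ) - j) atTop atTop :=
    tendsto_atTop_add_const_right _ _ tendsto_natCast_atTop_atTop
  have h2 : Tendsto (fun n : ℕ => c + c * j / ((n : ℝ) - j)) atTop (𝓝 (c + 0)) :=
    tendsto_const_nhds.add (h1.const_div_atTop _)
  rw [add_zero] at h2
  refine h2.congr' ?_
  filter_upwards [h1.eventually_gt_atTop 0] with n hn
  field_simp
  ring

/-- The points `1 - s / n ^ 3` are raised to powers of order `n`. -/
theorem tendsto_one_sub_pow (s : ℝ) (hs : 0 ≤ s) (j : ℕ) :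
    Tendsto (fun n : ℕ => (n : ℝ) ^ 2 * (1 - (1 - s / (n : ℝ) ^ 3) ^ (n - j))) atTop (𝓝 s) := by
  have hu : Tendsto (fun n : ℕ => ((n - j : ℕ) : ℝ) * (s / (n : ℝ) ^ 3)) atTop (𝓝 0) := by
    refine squeeze_zero (g := fun n : ℕ => s / (n : ℝ) ^ 2) (fun n => by positivity) (fun n => ?_)
      ((tendsto_natCast_pow_atTop (by norm_num)).const_div_atTop _)
    rcases Nat.eq_zero_or_pos n with rfl | hn
    · simp
    · have hn' : (0 : ℝ) < n := Nat.cast_pos.2 hn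
      have h1 : ((n - j : ℕ) : ℝ) ≤ n := Nat.cast_le.2 (Nat.sub_le n j)
      calc ((n - j : ℕ) : ℝ) * (s / (n : ℝ) ^ 3) ≤ n * (s / (n : ℝ) ^ 3) := by gcongr
        _ = s / (n : ℝ) ^ 2 := by field_simp
  have hup : Tendsto (fun n : ℕ => (n : ℝ) ^ 2 * (((n - j : ℕ) : ℝ) * (s / (n : ℝ) ^ 3)))
      atTop (𝓝 s) := by
    have h : Tendsto (fun n : ℕ => s - s * j / (n : ℝ)) atTop (𝓝 (s - 0)) :=
      tendsto_const_nhds.sub (tendsto_natCast_atTop_atTop.const_div_atTop _)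
    rw [sub_zero] at h
    refine h.congr' ?_
    filter_upwards [eventually_gt_atTop j] with n hn
    have hn' : (0 : ℝ) < n := Nat.cast_pos.2 (by omega)
    rw [Nat.cast_sub hn.le]
    field_simp
  have hlow : Tendsto (fun n : ℕ => (n : ℝ) ^ 2 * (((n - j : ℕ) : ℝ) * (s / (n : ℝ) ^ 3))
      / (1 + ((n - j : ℕ) : ℝ) * (s / (n : ℝ) ^ 3))) atTop (𝓝 s) := by
    have := hup.div (hu.const_add 1) (by norm_num)
    rwa [add_zero, div_one] at this
  refine tendsto_of_tendsto_of_tendsto_of_le_of_le' hlow hup ?_ ?_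
  all_goals
    filter_upwards [(tendsto_natCast_pow_atTop (k := 3) (by norm_num)).eventually_gt_atTop s]
      with n hn
    have h3 : 0 < (n : ℝ) ^ 3 := hs.trans_lt hn
    have hu0 : 0 ≤ s / (n : ℝ) ^ 3 := by positivity
    have hu1 : s / (n : ℝ) ^ 3 < 1 := (div_lt_one h3).2 hn
    generalize s / (n : ℝ) ^ 3 = u at *
  · rw [mul_div_assoc]
    refine mul_le_mul_of_nonneg_left ?_ (by positivity)
    have h1 : 1 + ((n - j : ℕ) : ℝ) * u ≤ (1 + u) ^ (n - j) :=
      one_add_mul_le_pow (by linarith) _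
    have h2 : (1 - u) ^ (n - j) * (1 + u) ^ (n - j) ≤ 1 := by
      rw [← mul_pow]
      exact pow_le_one₀ (mul_nonneg (by linarith) (by linarith)) (by nlinarith)
    have h3 : 0 ≤ (1 - u) ^ (n - j) := pow_nonneg (by linarith) _
    have h4 : 0 < 1 + ((n - j : ℕ) : ℝ) * u := by positivity
    rw [div_le_iff₀ h4]
    have := (mul_le_mul_of_nonneg_left h1 h3).trans h2
    linarith
  · refine mul_le_mul_of_nonneg_left ?_ (by positivity)
    have h1 := one_add_mul_le_pow (by linarith : (-2 : ℝ) ≤ -u) (n - j)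
    rw [← sub_eq_add_neg] at h1
    linarith

theorem tendsto_of_tendsto_mul {a u : ℕ → ℝ} {L : ℝ} (ha : Tendsto a atTop atTop)
    (h : Tendsto (fun n => a n * u n) atTop (𝓝 L)) : Tendsto u atTop (𝓝 0) := by
  refine (h.div_atTop ha).congr' ?_
  filter_upwards [ha.eventually_gt_atTop 0] with n hn
  field_simp

/-- If `1 - c n` is of order `1 / n ^ 2`, then the angle with cosine `c n` is of order `1 / n`. -/
theorem tendsto_mul_sin_arccos {c : ℕ → ℝ} {L : ℝ}
    (h : Tendsto (fun n : ℕ => (n : ℝ) ^ 2 * (1 - c n)) atTop (𝓝 L)) :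
    Tendsto (fun n => Real.arccos (c n)) atTop (𝓝 0) ∧
      Tendsto (fun n : ℕ => (n : ℝ) * Real.sin (Real.arccos (c n))) atTop (𝓝 (√(2 * L))) := by
  have hc : Tendsto c atTop (𝓝 1) := by
    have := (tendsto_of_tendsto_mul (tendsto_natCast_pow_atTop (by norm_num)) h).const_sub 1
    simpa using this
  constructor
  · have := (Real.continuous_arccos.tendsto 1).comp hc
    rwa [Real.arccos_one] at this
  · have h1 : Tendsto (fun n : ℕ => √((n : ℝ) ^ 2 * (1 - c n) * (1 + c n))) atTop
        (𝓝 (√(L * (1 + 1)))) := (h.mul (hc.const_add 1)).sqrt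
    have h2 : L * (1 + 1) = 2 * L := by ring
    rw [h2] at h1
    refine h1.congr fun n => ?_
    rw [Real.sin_arccos, mul_assoc, Real.sqrt_mul (by positivity), Real.sqrt_sq (by positivity)]
    congr 2
    ring

theorem tendsto_one_sub_div_cube (s : ℝ) :
    Tendsto (fun n : ℕ => 1 - s / (n : ℝ) ^ 3) atTop (𝓝 1) := by
  have := ((tendsto_natCast_pow_atTop (k := 3) (by norm_num)).const_div_atTop s).const_sub 1
  simpa using this

theorem tendsto_sq_mul_div_cube (s : ℝ) :
    Tendsto (fun n : ℕ => (n : ℝ) ^ 2 * (s / (n : ℝ) ^ 3)) atTop (𝓝 0) := by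
  refine (tendsto_natCast_atTop_atTop.const_div_atTop s).congr' ?_
  filter_upwards [eventually_gt_atTop 0] with n hn
  have : (0 : ℝ) < n := Nat.cast_pos.2 hn
  field_simp

theorem tendsto_mul_sin_div_sub {ψ : ℕ → ℝ} (hψ : Tendsto ψ atTop (𝓝 0)) (j : ℕ) (c : ℝ) :
    Tendsto (fun n : ℕ => (n : ℝ) * Real.sin (c * (2 * Real.pi - ψ n) / ((n : ℝ) - j)))
      atTop (𝓝 (c * (2 * Real.pi))) := by
  have h1 : Tendsto (fun n : ℕ => (n : ℝ) * (c * (2 * Real.pi - ψ n) / ((n : ℝ) - j)))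
      atTop (𝓝 (c * (2 * Real.pi))) := by
    have h := (tendsto_div_sub 1 j).mul ((hψ.const_sub (2 * Real.pi)).const_mul c)
    simp only [sub_zero, one_mul] at h
    refine h.congr fun n => ?_
    ring
  exact tendsto_mul_sin h1 (tendsto_of_tendsto_mul tendsto_natCast_atTop_atTop h1)

theorem one_sub_div_cube_pow_ge {n : ℕ} {s : ℝ} (hs : 0 ≤ s) (hn : 10 * s ≤ n) (hn0 : 1 ≤ n)
    {j : ℕ} (hj : j ≤ n) :
    9 / 10 ≤ (1 - s / (n : ℝ) ^ 3) ^ j := by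
  have hn' : (1 : ℝ) ≤ n := by exact_mod_cast hn0
  have hj' : (j : ℝ) ≤ n := by exact_mod_cast hj
  have hu : s / (n : ℝ) ^ 3 ≤ 1 / 10 := by
    rw [div_le_iff₀ (by positivity)]
    have : (n : ℝ) ≤ n ^ 3 := le_self_pow₀ hn' (by norm_num)
    linarith
  have h := one_add_mul_le_pow (by linarith : (-2 : ℝ) ≤ -(s / (n : ℝ) ^ 3)) j
  rw [← sub_eq_add_neg] at h
  refine le_trans ?_ h
  have : (j : ℝ) * (s / (n : ℝ) ^ 3) ≤ 1 / 10 := by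
    calc (j : ℝ) * (s / (n : ℝ) ^ 3) ≤ n * (s / (n : ℝ) ^ 3) := by gcongr
      _ = s / (n : ℝ) ^ 2 := by field_simp
      _ ≤ 1 / 10 := by
        rw [div_le_iff₀ (by positivity)]
        have : (n : ℝ) ≤ n ^ 2 := le_self_pow₀ hn' (by norm_num)
        linarith
  linarith

theorem norm_ofReal_mul_exp_sub_one_le (r θ : ℝ) :
    ‖(r : ℂ) * Complex.exp (θ * Complex.I) - 1‖ ≤ |1 - r| + |θ| := by
  have e : (r : ℂ) * Complex.exp (θ * Complex.I) - 1
      = (Complex.exp (Complex.I * θ) - 1) - ((1 - r : ℝ) : ℂ) * Complex.exp (θ * Complex.I) := by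
    rw [mul_comm Complex.I]
    push_cast
    ring
  rw [e]
  refine (norm_sub_le _ _).trans ?_
  rw [norm_mul, Complex.norm_exp_ofReal_mul_I, mul_one, Complex.norm_real, add_comm]
  exact add_le_add le_rfl Real.norm_exp_I_mul_ofReal_sub_one_le

theorem half_le_cos {x : ℝ} (hx : |x| ≤ 1) : 1 / 2 ≤ Real.cos x := by
  have h2 := Real.one_sub_sq_div_two_le_cos (x := x)
  have h3 : x ^ 2 ≤ 1 := (sq_le_one_iff_abs_le_one x).2 hx
  linarith

/-- A family of continuous functions that changes sign in the limit has zeros. -/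
theorem eventually_exists_eq_zero {F : ℕ → ℝ → ℝ} {s₀ s₁ a b : ℝ} (h01 : s₀ ≤ s₁)
    (hcont : ∀ᶠ n in atTop, ContinuousOn (F n) (Set.Icc s₀ s₁))
    (h0 : Tendsto (fun n => F n s₀) atTop (𝓝 a)) (ha : a < 0)
    (h1 : Tendsto (fun n => F n s₁) atTop (𝓝 b)) (hb : 0 < b) :
    ∀ᶠ n in atTop, ∃ s ∈ Set.Icc s₀ s₁, F n s = 0 := by
  filter_upwards [hcont, h0.eventually (gt_mem_nhds ha), h1.eventually (lt_mem_nhds hb)]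
    with n hn hn0 hn1
  exact intermediate_value_Icc h01 hn ⟨hn0.le, hn1.le⟩

end Limits

/-! ### The Rudvalis shuffle -/

section Rudvalis

open Filter Topology

/-- A card of the Rudvalis shuffle moves up by one position, deterministically, except from the
positions `0` and `n - 1`, so the position eigenfunctions are geometric sequences. -/
theorem isPositionEigenfunction_rudvalis {n : ℕ} (hn : 3 ≤ n) {l : ℂ} {K : ℝ}
    (hroot : (2 * l - 1) * l ^ (n - 2) = 1) (hlow : 1 / 2 ≤ ‖l‖) (hup : ‖l‖ ≤ 1) (hK : 0 ≤ K)
    (hl : ‖l - 1‖ ≤ K / n) :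
    IsPositionEigenfunction
      ![Fin.cycleRange (⟨n - 1, by omega⟩ : Fin n), Fin.cycleRange ⟨n - 2, by omega⟩]
      (fun _ => 1) (fun p : Fin n => if p.val + 1 = n then 1 else (l ^ p.val)⁻¹) l
      (2 * K + 3) := by
  have hl0 : l ≠ 0 := norm_pos_iff.1 (by linarith)
  have hinv : (l ^ (n - 2))⁻¹ = 2 * l - 1 := inv_eq_of_mul_eq_one_left hroot
  have hgap : ‖1 - (l ^ (n - 2))⁻¹‖ ≤ (2 * K + 3) / n := by
    rw [hinv, show 1 - (2 * l - 1) = -(2 * (l - 1)) by ring, norm_neg, norm_mul,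
      Complex.norm_ofNat]
    calc 2 * ‖l - 1‖ ≤ 2 * (K / n) := by linarith
      _ = 2 * K / n := by ring
      _ ≤ (2 * K + 3) / n := by gcongr; linarith
  have v0 : ∀ p : Fin n, ((Fin.cycleRange (⟨n - 1, by omega⟩ : Fin n))⁻¹ p).val
      = if p.val = 0 then n - 1 else p.val - 1 := by
    intro p
    have hp := p.isLt
    rw [val_cycleRange_inv]
    simp only
    split_ifs <;> omega
  have v1 : ∀ p : Fin n, ((Fin.cycleRange (⟨n - 2, by omega⟩ : Fin n))⁻¹ p).val
      = if p.val = 0 then n - 2 else if p.val + 1 = n then n - 1 else p.val - 1 := by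
    intro p
    have hp := p.isLt
    rw [val_cycleRange_inv]
    simp only
    split_ifs <;> omega
  refine ⟨fun p => ?_, ?_, fun p => ?_, fun p => ?_⟩
  · have hp := p.isLt
    simp only [Fin.sum_univ_two, Matrix.cons_val_zero, Matrix.cons_val_one, v0, v1,
      Circle.coe_one, one_mul]
    by_cases h0 : p.val = 0
    · rw [if_pos h0, if_pos h0, if_pos (by omega), if_neg (by omega), if_neg (by omega), hinv, h0]
      simp
    rw [if_neg h0, if_neg h0, if_neg (by omega)]
    by_cases h1 : p.val + 1 = n
    · rw [if_pos h1, if_pos h1, if_pos (by omega), show p.val - 1 = n - 2 by omega, hinv]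
      push_cast
      ring
    · rw [if_neg h1, if_neg h1, if_neg (by omega)]
      obtain ⟨q, hq⟩ := Nat.exists_eq_succ_of_ne_zero h0
      rw [hq, Nat.succ_sub_one, pow_succ]
      push_cast
      field_simp
      norm_num
  · refine ⟨fun p => if ((Fin.cycleRange (⟨n - 2, by omega⟩ : Fin n))⁻¹ p).val + 1 = n then 1
      else (l ^ ((Fin.cycleRange (⟨n - 2, by omega⟩ : Fin n))⁻¹ p).val)⁻¹, ?_⟩
    have hpos : 0 ≤ (2 * K + 3) / (n : ℝ) ^ 2 := by positivity
    have hpos' : 0 ≤ (2 * K + 3) / (n : ℝ) := by positivity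
    have hgap' := hgap
    rw [norm_sub_rev] at hgap'
    have hbound : ∀ p : Fin n, 0 ≤ (2 * K + 3) / (n : ℝ) ^ 2
        + if p.val ≤ 1 ∨ p.val + 1 = n then (2 * K + 3) / n else 0 := by
      intro p
      split_ifs <;> linarith
    refine Fin.forall_fin_two.2 ⟨fun p => ?_, fun p => ?_⟩
    · have hp := p.isLt
      have hbound := hbound p
      simp only [Matrix.cons_val_zero, v0, v1, Circle.coe_one, one_mul]
      by_cases h0 : p.val = 0
      · rw [if_pos h0, if_pos h0, if_pos (by omega), if_neg (by omega), if_pos (by omega)]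
        linarith
      rw [if_neg h0, if_neg h0, if_neg (by omega)]
      by_cases h1 : p.val + 1 = n
      · rw [if_pos h1, if_pos (by omega), if_pos (by omega), show p.val - 1 = n - 2 by omega]
        linarith
      · rw [if_neg h1, if_neg (by omega), sub_self, norm_zero]
        exact hbound
    · simp only [Matrix.cons_val_one, Matrix.cons_val_zero, Circle.coe_one, one_mul]
      refine (norm_le_zero_iff.2 (sub_eq_zero.2 rfl)).trans ?_
      exact hbound p
  · have hp := p.isLt
    split_ifs with h
    · norm_num
    · rw [norm_inv, norm_pow]
      have h1 : ‖l‖ ^ p.val ≤ 1 := pow_le_one₀ (norm_nonneg _) hup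
      have h2 : 0 < ‖l‖ ^ p.val := pow_pos (by linarith) _
      have := (one_le_inv₀ h2).2 h1
      linarith
  · have hp := p.isLt
    split_ifs with h
    · rw [norm_one]
      linarith
    · have h1 : ‖(l ^ p.val)⁻¹‖ ≤ ‖(l ^ (n - 2))⁻¹‖ := by
        rw [norm_inv, norm_inv, norm_pow, norm_pow]
        have h2 : 0 < ‖l‖ ^ (n - 2) := pow_pos (by linarith) _
        refine inv_anti₀ h2 (pow_le_pow_of_le_one (norm_nonneg _) hup (by omega))
      have h2 : ‖(l ^ (n - 2))⁻¹‖ ≤ 3 := by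
        rw [hinv]
        calc ‖2 * l - 1‖ ≤ ‖2 * l‖ + ‖(1 : ℂ)‖ := norm_sub_le _ _
          _ = 2 * ‖l‖ + 1 := by simp
          _ ≤ 3 := by linarith
      linarith

/-- The polar form of the equation for the eigenvalue `l = r * exp (i θ)`: with `E = r ^ (2 - n)`
and `(n - 2) θ = 2 π - ψ` it says `2 l - 1 = E * exp (i ψ)`. The moduli of `2 l` and
`1 + E * exp (i ψ)` agree by the choice of `cos ψ`, so it is enough to compare imaginary parts. -/
theorem rudvalis_root_of_polar {n : ℕ} (hn : 6 ≤ n) {r E ψ θ : ℝ} (hr : 9 / 10 ≤ r)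
    (hE : E = (r ^ (n - 2))⁻¹) (hE2 : E ≤ 2) (hψ : 0 ≤ ψ) (hψπ : ψ ≤ Real.pi)
    (hcos : Real.cos ψ = (4 * r ^ 2 - 1 - E ^ 2) / (2 * E))
    (hθ : θ = (2 * Real.pi - ψ) / ((n : ℝ) - 2)) (him : E * Real.sin ψ = 2 * r * Real.sin θ) :
    (2 * (r * Complex.exp (θ * Complex.I)) - 1) * (r * Complex.exp (θ * Complex.I)) ^ (n - 2)
      = 1 := by
  have hn6 : (6 : ℝ) ≤ n := by exact_mod_cast hn
  have hr0 : 0 < r := by linarith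
  have hE0 : 0 < E := by rw [hE]; positivity
  have hθ0 : 0 ≤ θ := by
    rw [hθ]
    exact div_nonneg (by linarith [Real.pi_pos]) (by linarith)
  have hθ2 : θ ≤ Real.pi / 2 := by
    rw [hθ, div_le_iff₀ (by linarith)]
    nlinarith [Real.pi_pos]
  have hre : 2 * r * Real.cos θ - 1 = E * Real.cos ψ := by
    have h1 : E * Real.cos ψ = (4 * r ^ 2 - 1 - E ^ 2) / 2 := by
      rw [hcos]
      field_simp
    have h2 : 0 ≤ E * Real.cos ψ + 1 := by
      rw [h1]
      nlinarith
    have h3 : 0 ≤ 2 * r * Real.cos θ := by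
      have := Real.cos_nonneg_of_neg_pi_div_two_le_of_le (by linarith [Real.pi_pos]) hθ2
      positivity
    have h4 : (2 * r * Real.cos θ) ^ 2 = (E * Real.cos ψ + 1) ^ 2 := by
      have h5 := Real.sin_sq_add_cos_sq ψ
      have h6 := Real.sin_sq_add_cos_sq θ
      have h7 : (E * Real.sin ψ) ^ 2 = (2 * r * Real.sin θ) ^ 2 := by rw [him]
      linear_combination 4 * r ^ 2 * h6 - E ^ 2 * h5 + h7 - 2 * h1
    have h5 := (pow_left_inj₀ h3 h2 two_ne_zero).1 h4
    linarith
  have hlin : 2 * (r * Complex.exp (θ * Complex.I)) - 1 = E * Complex.exp (ψ * Complex.I) := by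
    apply Complex.ext
    · simpa [Complex.exp_ofReal_mul_I_re, Complex.exp_ofReal_mul_I_im, mul_assoc] using hre
    · simpa [Complex.exp_ofReal_mul_I_re, Complex.exp_ofReal_mul_I_im, mul_assoc] using him.symm
  have hangle : ((n - 2 : ℕ) : ℂ) * (θ * Complex.I) = 2 * Real.pi * Complex.I - ψ * Complex.I := by
    have h1 : ((n : ℝ) - 2) * θ = 2 * Real.pi - ψ := by
      rw [hθ]
      have : (n : ℝ) - 2 ≠ 0 := by linarith
      field_simp
    have h2 : (((n : ℝ) - 2) * θ : ℝ) * Complex.I = ((2 * Real.pi - ψ : ℝ) : ℂ) * Complex.I := by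
      rw [h1]
    push_cast [Nat.cast_sub (by omega : 2 ≤ n)] at h2 ⊢
    linear_combination h2
  rw [hlin, mul_pow, ← Complex.exp_nat_mul, hangle, hE, Complex.exp_sub, Complex.exp_two_pi_mul_I]
  have hrc : (r : ℂ) ≠ 0 := Complex.ofReal_ne_zero.2 hr0.ne'
  have hec := Complex.exp_ne_zero (ψ * Complex.I)
  push_cast
  field_simp

/-- `E * sin ψ - 2 * r * sin θ`, scaled by `n`, in the notation of `rudvalis_root_of_polar` with
`r = 1 - s / n ^ 3`. -/
noncomputable def rudvalisDefect (n : ℕ) (s : ℝ) : ℝ :=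
  let r := 1 - s / (n : ℝ) ^ 3
  let E := (r ^ (n - 2))⁻¹
  let ψ := Real.arccos ((4 * r ^ 2 - 1 - E ^ 2) / (2 * E))
  (n : ℝ) * (E * Real.sin ψ - 2 * r * Real.sin ((2 * Real.pi - ψ) / ((n : ℝ) - 2)))

theorem tendsto_rudvalisDefect {s : ℝ} (hs : 0 ≤ s) :
    Tendsto (fun n => rudvalisDefect n s) atTop (𝓝 (2 * √s - 4 * Real.pi)) := by
  have hr := tendsto_one_sub_div_cube s
  have hp2 := tendsto_one_sub_pow s hs 2
  have hp : Tendsto (fun n : ℕ => (1 - s / (n : ℝ) ^ 3) ^ (n - 2)) atTop (𝓝 1) := by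
    have := (tendsto_of_tendsto_mul (tendsto_natCast_pow_atTop (by norm_num)) hp2).const_sub 1
    simpa using this
  have hE : Tendsto (fun n : ℕ => ((1 - s / (n : ℝ) ^ 3) ^ (n - 2))⁻¹) atTop (𝓝 1) := by
    simpa using hp.inv₀ one_ne_zero
  have hcos : Tendsto (fun n : ℕ => (n : ℝ) ^ 2 * (1 - (4 * (1 - s / (n : ℝ) ^ 3) ^ 2 - 1
      - (((1 - s / (n : ℝ) ^ 3) ^ (n - 2))⁻¹) ^ 2) / (2 * ((1 - s / (n : ℝ) ^ 3) ^ (n - 2))⁻¹)))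
      atTop (𝓝 (2 * s)) := by
    -- `1 - cos ψ = ((1 - P) / P + 2 * (1 - r)) * (1 + E + 2 * r) * (P / 2)` with `P = 1 / E`
    have h1 := (hp2.mul hE).add ((tendsto_sq_mul_div_cube s).const_mul 2)
    have h2 := ((hE.const_add 1).add (hr.const_mul 2)).mul (hp.div_const 2)
    have h3 := h1.mul h2
    have e : (s * 1 + 2 * 0) * ((1 + 1 + 2 * 1) * (1 / 2)) = 2 * s := by ring
    rw [e] at h3
    refine h3.congr' ?_
    filter_upwards [hp.eventually (lt_mem_nhds one_pos)] with n hn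
    generalize hP : (1 - s / (n : ℝ) ^ 3) ^ (n - 2) = P at *
    generalize s / (n : ℝ) ^ 3 = u at *
    field_simp
    ring
  obtain ⟨hψ, hsin⟩ := tendsto_mul_sin_arccos hcos
  have hsin2 := tendsto_mul_sin_div_sub hψ 2 1
  have h := (hE.mul hsin).sub ((hr.const_mul 2).mul hsin2)
  have e : 1 * √(2 * (2 * s)) - 2 * 1 * (1 * (2 * Real.pi)) = 2 * √s - 4 * Real.pi := by
    rw [show 2 * (2 * s) = 2 ^ 2 * s by ring, Real.sqrt_mul (by norm_num),
      Real.sqrt_sq (by norm_num)]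
    ring
  rw [e] at h
  refine h.congr fun n => ?_
  simp only [rudvalisDefect, one_mul, Nat.cast_ofNat]
  ring

theorem continuousOn_rudvalisDefect {n : ℕ} {s₀ s₁ : ℝ} (h1 : s₁ < (n : ℝ) ^ 3) (h0 : 0 < s₀) :
    ContinuousOn (rudvalisDefect n) (Set.Icc s₀ s₁) := by
  have hr : ∀ s ∈ Set.Icc s₀ s₁, (1 - s / (n : ℝ) ^ 3) ^ (n - 2) ≠ 0 := by
    intro s hs
    have : s / (n : ℝ) ^ 3 < 1 := (div_lt_one (by linarith [hs.1, hs.2])).2 (by linarith [hs.2])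
    exact pow_ne_zero _ (by linarith)
  have hrc : ContinuousOn (fun s : ℝ => 1 - s / (n : ℝ) ^ 3) (Set.Icc s₀ s₁) :=
    continuousOn_const.sub (continuousOn_id.div_const _)
  have hE : ContinuousOn (fun s : ℝ => ((1 - s / (n : ℝ) ^ 3) ^ (n - 2))⁻¹) (Set.Icc s₀ s₁) :=
    (hrc.pow _).inv₀ hr
  have hψ : ContinuousOn (fun s : ℝ => Real.arccos ((4 * (1 - s / (n : ℝ) ^ 3) ^ 2 - 1
      - (((1 - s / (n : ℝ) ^ 3) ^ (n - 2))⁻¹) ^ 2) / (2 * ((1 - s / (n : ℝ) ^ 3) ^ (n - 2))⁻¹)))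
      (Set.Icc s₀ s₁) := by
    refine Real.continuous_arccos.comp_continuousOn (ContinuousOn.div
      (((continuousOn_const.mul (hrc.pow 2)).sub continuousOn_const).sub (hE.pow 2))
      (continuousOn_const.mul hE) fun s hs => mul_ne_zero two_ne_zero (inv_ne_zero (hr s hs)))
  have hdef : rudvalisDefect n = fun s => (n : ℝ) * (((1 - s / (n : ℝ) ^ 3) ^ (n - 2))⁻¹
      * Real.sin (Real.arccos ((4 * (1 - s / (n : ℝ) ^ 3) ^ 2 - 1
        - (((1 - s / (n : ℝ) ^ 3) ^ (n - 2))⁻¹) ^ 2) / (2 * ((1 - s / (n : ℝ) ^ 3) ^ (n - 2))⁻¹)))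
      - 2 * (1 - s / (n : ℝ) ^ 3) * Real.sin ((2 * Real.pi - Real.arccos
        ((4 * (1 - s / (n : ℝ) ^ 3) ^ 2 - 1 - (((1 - s / (n : ℝ) ^ 3) ^ (n - 2))⁻¹) ^ 2)
          / (2 * ((1 - s / (n : ℝ) ^ 3) ^ (n - 2))⁻¹))) / ((n : ℝ) - 2))) := rfl
  rw [hdef]
  refine continuousOn_const.mul ((hE.mul (Real.continuous_sin.comp_continuousOn hψ)).sub
    ((continuousOn_const.mul hrc).mul (Real.continuous_sin.comp_continuousOn
      ((continuousOn_const.sub hψ).div_const _))))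

/-- The Rudvalis shuffle has position eigenfunctions with `1 - ‖l‖ ~ 4 π ^ 2 / n ^ 3`. -/
theorem eventually_exists_rudvalis_eigenfunction {s₀ s₁ : ℝ} (h0 : 0 < s₀)
    (h0' : s₀ < 4 * Real.pi ^ 2) (h1 : 4 * Real.pi ^ 2 < s₁) :
    ∀ᶠ n : ℕ in atTop, ∀ hn : 2 ≤ n,
      ∃ (τ : Fin 2 → Equiv.Perm (Fin n)) (w : Fin 2 → Circle) (g : Fin n → ℂ) (l : ℂ),
        rudvalisStep hn = randomMove (fun j d => d * τ j) ∧
        IsPositionEigenfunction τ w g l (2 * (s₁ + 4 * Real.pi) + 3) ∧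
        s₀ / n ^ 3 ≤ 1 - ‖l‖ ∧ 1 - ‖l‖ ≤ s₁ / n ^ 3 := by
  have hpi := Real.pi_pos
  have hs1 : 0 < s₁ := lt_trans (by positivity) h1
  have hsqrt : √(4 * Real.pi ^ 2) = 2 * Real.pi := by
    rw [show 4 * Real.pi ^ 2 = (2 * Real.pi) ^ 2 by ring, Real.sqrt_sq (by positivity)]
  have hroots := eventually_exists_eq_zero (F := rudvalisDefect) (h0'.trans h1).le
    (by
      filter_upwards [(tendsto_natCast_pow_atTop (k := 3) (by norm_num)).eventually_gt_atTop s₁]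
        with n hn using continuousOn_rudvalisDefect hn h0)
    (tendsto_rudvalisDefect h0.le)
    (by have := Real.sqrt_lt_sqrt h0.le h0'; linarith)
    (tendsto_rudvalisDefect hs1.le)
    (by have := Real.sqrt_lt_sqrt (by positivity) h1; linarith)
  filter_upwards [hroots, eventually_ge_atTop 6,
    tendsto_natCast_atTop_atTop.eventually_ge_atTop (10 * s₁)] with n hroot hn6 hns hn
  obtain ⟨s, ⟨hs0, hs1'⟩, hzero⟩ := hroot
  have hn6' : (6 : ℝ) ≤ n := by exact_mod_cast hn6
  have hspos : 0 < s := h0.trans_le hs0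
  have hns' : 10 * s ≤ n := by linarith
  have hr := one_sub_div_cube_pow_ge hspos.le hns' (by omega) (j := 1) (by omega)
  have hP := one_sub_div_cube_pow_ge hspos.le hns' (by omega) (j := n - 2) (by omega)
  rw [pow_one] at hr
  simp only [rudvalisDefect] at hzero
  have hu : 0 < s / (n : ℝ) ^ 3 := by positivity
  have hus : s / (n : ℝ) ^ 3 ≤ s₁ / n := by
    have : (n : ℝ) ≤ n ^ 3 := le_self_pow₀ (by linarith) (by norm_num)
    gcongr
  set r := 1 - s / (n : ℝ) ^ 3 with hrdef
  set E := (r ^ (n - 2))⁻¹ with hE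
  set ψ := Real.arccos ((4 * r ^ 2 - 1 - E ^ 2) / (2 * E)) with hψ
  set θ := (2 * Real.pi - ψ) / ((n : ℝ) - 2) with hθ
  have hr1 : r ≤ 1 := by linarith
  have hP0 : 0 < r ^ (n - 2) := by linarith
  have hE2 : E ≤ 2 := by
    rw [hE, inv_le_comm₀ hP0 (by norm_num)]
    linarith
  have hE1 : 1 ≤ E := (one_le_inv₀ hP0).2 (pow_le_one₀ (by linarith) hr1)
  have hψ0 : 0 ≤ ψ := Real.arccos_nonneg _
  have hψπ : ψ ≤ Real.pi := Real.arccos_le_pi _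
  have hcos : Real.cos ψ = (4 * r ^ 2 - 1 - E ^ 2) / (2 * E) := by
    refine Real.cos_arccos ?_ ?_
    · rw [le_div_iff₀ (by linarith)]
      nlinarith
    · rw [div_le_iff₀ (by linarith)]
      nlinarith
  have him : E * Real.sin ψ = 2 * r * Real.sin θ := by
    rcases mul_eq_zero.1 hzero with h | h
    · linarith
    · linarith
  have hl := rudvalis_root_of_polar hn6 hr hE hE2 hψ0 hψπ hcos hθ him
  have hnorm : ‖(r : ℂ) * Complex.exp (θ * Complex.I)‖ = r := by
    rw [norm_mul, Complex.norm_exp_ofReal_mul_I, mul_one, Complex.norm_real, Real.norm_eq_abs,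
      abs_of_nonneg (by linarith)]
  have hθ0 : 0 ≤ θ := div_nonneg (by linarith) (by linarith)
  have hθn : θ ≤ 4 * Real.pi / n := by
    rw [hθ, div_le_div_iff₀ (by linarith) (by linarith)]
    nlinarith
  refine ⟨_, _, _, _, ?_, isPositionEigenfunction_rudvalis (by omega) hl (by linarith)
    (by linarith) (by positivity) ?_, ?_, ?_⟩
  · unfold rudvalisStep
    congr 1
    funext j
    fin_cases j <;> rfl
  · refine (norm_ofReal_mul_exp_sub_one_le r θ).trans ?_
    rw [abs_of_nonneg (by linarith), abs_of_nonneg hθ0, add_div]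
    linarith
  · rw [hnorm, hrdef, sub_sub_cancel]
    gcongr
  · rw [hnorm, hrdef, sub_sub_cancel]
    gcongr

end Rudvalis

/-! ### The shift-or-swap shuffle -/

section ShiftOrSwap

open Filter Topology

/-- The shift carries the weight `ζ` and the exchange of the top two cards carries the weight `1`;
away from the top of the deck the position eigenfunctions are geometric sequences. -/
theorem isPositionEigenfunction_shiftOrSwap {n : ℕ} (hn : 3 ≤ n) {R K : ℝ} {ζ : Circle} {ρ : ℂ}
    (hζ : (ζ : ℂ) = R * ρ) (hroot : ρ - (2 + R) + (1 + ζ) * ρ ^ (n - 1) = 0)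
    (hR : 9 / 10 ≤ R) (hR1 : R ≤ 1) (hK : 0 ≤ K) (hRK : 1 - R ≤ K / n ^ 3)
    (hζ1 : ‖(ζ : ℂ) - 1‖ ≤ K / n) (hζ2 : 1 ≤ ‖1 + (ζ : ℂ)‖) :
    IsPositionEigenfunction
      ![Fin.cycleRange (⟨n - 1, by omega⟩ : Fin n), Equiv.swap ⟨0, by omega⟩ ⟨1, by omega⟩]
      ![ζ, 1] (fun p : Fin n => if p.val = 0 then (1 + R) / (1 + ζ) else ρ ^ (p.val - 1))
      ((1 + R) / 2) (6 * K + 5) := by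
  have hn1 : (1 : ℝ) ≤ n := by exact_mod_cast (by omega : 1 ≤ n)
  have hζ0 : 1 + (ζ : ℂ) ≠ 0 := norm_pos_iff.1 (by linarith)
  have hζn : ‖(ζ : ℂ)‖ = 1 := Circle.norm_coe ζ
  have hRn : ‖(R : ℂ)‖ = R := by
    rw [Complex.norm_real, Real.norm_eq_abs, abs_of_nonneg (by linarith)]
  have hR1n : ‖1 + (R : ℂ)‖ = 1 + R := by
    rw [← Complex.ofReal_one, ← Complex.ofReal_add, Complex.norm_real, Real.norm_eq_abs,
      abs_of_nonneg (by linarith)]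
  have hρ1 : 1 ≤ ‖ρ‖ := by
    have h1 : R * ‖ρ‖ = 1 := by rw [← hζn, hζ, norm_mul, hRn]
    nlinarith [norm_nonneg ρ]
  have hpow : (ζ : ℂ) * ρ ^ (n - 2) = (1 + R) ^ 2 / (1 + ζ) - 1 := by
    have h1 : ρ ^ (n - 1) = ρ ^ (n - 2) * ρ := by
      rw [← pow_succ]
      congr 1
      omega
    rw [h1] at hroot
    rw [eq_sub_iff_add_eq, eq_div_iff hζ0]
    linear_combination (R : ℂ) * hroot + ((1 + (ζ : ℂ)) * ρ ^ (n - 2) + 1) * hζ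
  have hbound : ∀ i, i ≤ n - 2 → ‖ρ ^ i‖ ≤ 5 := by
    intro i hi
    have h1 : ‖ρ ^ i‖ ≤ ‖(ζ : ℂ) * ρ ^ (n - 2)‖ := by
      rw [norm_mul, hζn, one_mul, norm_pow, norm_pow]
      exact pow_le_pow_right₀ hρ1 hi
    refine h1.trans ?_
    rw [hpow]
    refine (norm_sub_le _ _).trans ?_
    rw [norm_div, norm_pow, hR1n, norm_one]
    have h2 : (1 + R) ^ 2 / ‖1 + (ζ : ℂ)‖ ≤ 4 := by
      rw [div_le_iff₀ (by linarith)]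
      nlinarith
    linarith
  have htop : ‖(1 + (R : ℂ)) / (1 + ζ)‖ ≤ 2 := by
    rw [norm_div, hR1n, div_le_iff₀ (by linarith)]
    linarith
  have hKn : K / (n : ℝ) ^ 3 ≤ K / n := by
    have : (n : ℝ) ≤ n ^ 3 := le_self_pow₀ hn1 (by norm_num)
    gcongr
  have hKn2 : K / (n : ℝ) ^ 3 ≤ K / n ^ 2 := by
    have : (n : ℝ) ^ 2 ≤ n ^ 3 := pow_le_pow_right₀ hn1 (by norm_num)
    gcongr
  have v0 : ∀ p : Fin n, ((Fin.cycleRange (⟨n - 1, by omega⟩ : Fin n))⁻¹ p).val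
      = if p.val = 0 then n - 1 else p.val - 1 := by
    intro p
    have hp := p.isLt
    rw [val_cycleRange_inv]
    simp only
    split_ifs <;> omega
  have v1 : ∀ p : Fin n, ((Equiv.swap (⟨0, by omega⟩ : Fin n) ⟨1, by omega⟩)⁻¹ p).val
      = if p.val = 0 then 1 else if p.val = 1 then 0 else p.val := by
    intro p
    rw [Equiv.swap_inv, val_swap_zero_one (by omega)]
  refine ⟨fun p => ?_, ?_, fun p => ?_, fun p => ?_⟩
  · have hp := p.isLt
    simp only [Fin.sum_univ_two, Matrix.cons_val_zero, Matrix.cons_val_one, v0, v1,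
      Circle.coe_one, one_mul]
    by_cases h0 : p.val = 0
    · rw [if_pos h0, if_pos h0, if_neg (by omega), if_neg (by omega), if_pos h0,
        show n - 1 - 1 = n - 2 by omega, hpow]
      push_cast
      field_simp
      ring
    rw [if_neg h0, if_neg h0, if_neg h0]
    by_cases h1 : p.val = 1
    · rw [if_pos h1, if_pos rfl, if_pos (by omega), h1]
      push_cast
      field_simp
      ring
    · rw [if_neg h1, if_neg (by omega), if_neg h0]
      obtain ⟨q, hq⟩ := Nat.exists_eq_add_of_le (by omega : 2 ≤ p.val)
      rw [hq, show 2 + q - 1 = q + 1 by omega, show q + 1 - 1 = q by omega, pow_succ, hζ]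
      push_cast
      ring
  · refine ⟨fun p => if ((Equiv.swap (⟨0, by omega⟩ : Fin n) ⟨1, by omega⟩)⁻¹ p).val = 0
      then (1 + R) / (1 + ζ)
      else ρ ^ (((Equiv.swap (⟨0, by omega⟩ : Fin n) ⟨1, by omega⟩)⁻¹ p).val - 1),
      ?_⟩
    have hpos : 0 ≤ (6 * K + 5) / (n : ℝ) ^ 2 := by positivity
    have hpos' : 0 ≤ (6 * K + 5) / (n : ℝ) := by positivity
    have hsix : 6 * (K / (n : ℝ)) ≤ (6 * K + 5) / n := by
      rw [mul_div_assoc']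
      gcongr
      linarith
    have hfive : 5 * (K / (n : ℝ) ^ 2) ≤ (6 * K + 5) / n ^ 2 := by
      rw [mul_div_assoc']
      gcongr
      linarith
    refine Fin.forall_fin_two.2 ⟨fun p => ?_, fun p => ?_⟩
    · have hp := p.isLt
      simp only [Matrix.cons_val_zero, v0, v1]
      by_cases h0 : p.val = 0
      · rw [if_pos h0, if_pos h0, if_neg (by omega), if_neg (by omega), if_pos (by omega),
          show n - 1 - 1 = n - 2 by omega, hpow]
        have e : (1 + (R : ℂ)) ^ 2 / (1 + ζ) - 1 - ρ ^ (1 - 1)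
            = (-(((1 - R) * (3 + R) : ℝ) : ℂ) - 2 * (ζ - 1)) / (1 + ζ) := by
          push_cast
          field_simp
          ring
        rw [e, norm_div]
        refine (div_le_self (norm_nonneg _) hζ2).trans ?_
        refine (norm_sub_le _ _).trans ?_
        rw [norm_neg, norm_mul, Complex.norm_ofNat, Complex.norm_real, Real.norm_eq_abs,
          abs_of_nonneg (mul_nonneg (by linarith) (by linarith))]
        have : (1 - R) * (3 + R) ≤ (1 - R) * 4 :=
          mul_le_mul_of_nonneg_left (by linarith) (by linarith)
        linarith
      rw [if_neg h0, if_neg h0]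
      by_cases h1 : p.val = 1
      · rw [if_pos h1, if_pos rfl, if_pos (by omega), if_pos (by omega)]
        have e : (ζ : ℂ) * ((1 + R) / (1 + ζ)) - (1 + R) / (1 + ζ)
            = (ζ - 1) * ((1 + R) / (1 + ζ)) := by ring
        rw [e, norm_mul]
        have : ‖(ζ : ℂ) - 1‖ * ‖(1 + (R : ℂ)) / (1 + ζ)‖ ≤ K / n * 2 :=
          mul_le_mul hζ1 htop (norm_nonneg _) (by positivity)
        have : 0 ≤ K / (n : ℝ) := by positivity
        linarith
      · rw [if_neg h1, if_neg h0, if_neg (by omega)]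
        obtain ⟨q, hq⟩ := Nat.exists_eq_add_of_le (by omega : 2 ≤ p.val)
        have e : (ζ : ℂ) * ρ ^ (p.val - 1 - 1) - ρ ^ (p.val - 1)
            = -((1 - R : ℝ) : ℂ) * ρ ^ (p.val - 1) := by
          rw [hq, show 2 + q - 1 = q + 1 by omega, show q + 1 - 1 = q by omega, pow_succ, hζ]
          push_cast
          ring
        rw [e, norm_mul, norm_neg, Complex.norm_real, Real.norm_eq_abs,
          abs_of_nonneg (by linarith)]
        have h2 : (1 - R) * ‖ρ ^ (p.val - 1)‖ ≤ K / n ^ 2 * 5 :=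
          mul_le_mul (hRK.trans hKn2) (hbound _ (by omega)) (norm_nonneg _) (by positivity)
        split_ifs <;> linarith
    · simp only [Matrix.cons_val_one, Matrix.cons_val_zero, Circle.coe_one, one_mul]
      refine (norm_le_zero_iff.2 (sub_eq_zero.2 rfl)).trans ?_
      split_ifs <;> linarith
  · split_ifs with h
    · rw [norm_div, hR1n]
      have h1 : ‖1 + (ζ : ℂ)‖ ≤ 2 := by
        refine (norm_add_le _ _).trans ?_
        rw [norm_one, hζn]
        norm_num
      rw [le_div_iff₀ (by linarith)]
      linarith
    · rw [norm_pow]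
      have := one_le_pow₀ hρ1 (n := p.val - 1)
      linarith
  · have hp := p.isLt
    split_ifs with h
    · linarith
    · have := hbound (p.val - 1) (by omega)
      linarith

/-- The polar form of the eigenvalue equation, with `R = 2 l - 1` real, `ζ = exp (i y)`,
`(n - 1) y = 2 π - ψ` and `E = R ^ (1 - n)`: after division by `exp (i y / 2)` its real part
determines `cos ψ`, and its imaginary part is `him`. -/
theorem shiftOrSwap_root_of_polar {n : ℕ} (hn : 2 ≤ n) {R E ψ y : ℝ} (hR : 0 < R)
    (hE : E = (R ^ (n - 1))⁻¹) (hcos : Real.cos ψ = (2 + R - R⁻¹) * R ^ (n - 1) / 2)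
    (hy : y = (2 * Real.pi - ψ) / ((n : ℝ) - 1))
    (him : 2 * R * E * Real.sin ψ * Real.cos (y / 2) = (1 + R) ^ 2 * Real.sin (y / 2)) :
    Complex.exp (y * Complex.I) / R - (2 + R)
      + (1 + Complex.exp (y * Complex.I)) * (Complex.exp (y * Complex.I) / R) ^ (n - 1) = 0 := by
  have hn2 : (2 : ℝ) ≤ n := by exact_mod_cast hn
  have hRc : (R : ℂ) ≠ 0 := Complex.ofReal_ne_zero.2 hR.ne'
  have hangle : ((n - 1 : ℕ) : ℂ) * (y * Complex.I) = 2 * Real.pi * Complex.I - ψ * Complex.I := by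
    have h1 : ((n : ℝ) - 1) * y = 2 * Real.pi - ψ := by
      rw [hy]
      have : (n : ℝ) - 1 ≠ 0 := by linarith
      field_simp
    have h2 : (((n : ℝ) - 1) * y : ℝ) * Complex.I = ((2 * Real.pi - ψ : ℝ) : ℂ) * Complex.I := by
      rw [h1]
    push_cast [Nat.cast_sub (by omega : 1 ≤ n)] at h2 ⊢
    linear_combination h2
  have hpow : (Complex.exp (y * Complex.I) / R) ^ (n - 1) = E * Complex.exp (-ψ * Complex.I) := by
    rw [div_pow, ← Complex.exp_nat_mul, hangle, hE, sub_eq_add_neg, Complex.exp_add,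
      Complex.exp_two_pi_mul_I]
    push_cast
    field_simp
  have hEcos : 2 * E * Real.cos ψ = 2 + R - R⁻¹ := by
    have : R ^ (n - 1) ≠ 0 := pow_ne_zero _ hR.ne'
    rw [hcos, hE]
    field_simp
  have him' : 2 * E * Real.sin ψ * Real.cos (y / 2) = (R⁻¹ + 2 + R) * Real.sin (y / 2) := by
    have h1 : (R⁻¹ + 2 + R) * Real.sin (y / 2) = R⁻¹ * ((1 + R) ^ 2 * Real.sin (y / 2)) := by
      field_simp
      ring
    rw [h1, ← him]
    field_simp
  have hhalf : Complex.exp (y * Complex.I) = Complex.exp ((y / 2 : ℝ) * Complex.I) ^ 2 := by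
    rw [← Complex.exp_nat_mul]
    congr 1
    push_cast
    ring
  have hcosC := congrArg (fun x : ℝ => (x : ℂ)) hEcos
  have himC := congrArg (fun x : ℝ => (x : ℂ)) him'
  have htrig := congrArg (fun x : ℝ => (x : ℂ)) (Real.sin_sq_add_cos_sq (y / 2))
  rw [hpow, hhalf, Complex.exp_mul_I, Complex.exp_mul_I, ← Complex.ofReal_cos,
    ← Complex.ofReal_sin, Complex.cos_neg, Complex.sin_neg, ← Complex.ofReal_cos,
    ← Complex.ofReal_sin, div_eq_mul_inv, ← Complex.ofReal_inv]
  simp only [Complex.ofReal_mul, Complex.ofReal_add, Complex.ofReal_sub, Complex.ofReal_pow,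
    Complex.ofReal_ofNat, Complex.ofReal_one] at hcosC himC htrig
  generalize ((Real.cos (y / 2) : ℝ) : ℂ) = c at *
  generalize ((Real.sin (y / 2) : ℝ) : ℂ) = t at *
  generalize ((Real.cos ψ : ℝ) : ℂ) = a at *
  generalize ((Real.sin ψ : ℝ) : ℂ) = b at *
  generalize ((R⁻¹ : ℝ) : ℂ) = S at *
  have hI : Complex.I ^ 2 = -1 := Complex.I_sq
  linear_combination (c + t * Complex.I) * (c * hcosC - Complex.I * himC)
    + ((2 + R) - E * (a - b * Complex.I)) * (htrig - t ^ 2 * hI)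

/-- The difference of the two sides of `him` in `shiftOrSwap_root_of_polar`, scaled by `n`, with
`R = 1 - s / n ^ 3`. -/
noncomputable def shiftOrSwapDefect (n : ℕ) (s : ℝ) : ℝ :=
  let R := 1 - s / (n : ℝ) ^ 3
  let ψ := Real.arccos ((2 + R - R⁻¹) * R ^ (n - 1) / 2)
  let y := (2 * Real.pi - ψ) / ((n : ℝ) - 1)
  (n : ℝ) * (2 * R * (R ^ (n - 1))⁻¹ * Real.sin ψ * Real.cos (y / 2)
    - (1 + R) ^ 2 * Real.sin (y / 2))

theorem tendsto_shiftOrSwapDefect {s : ℝ} (hs : 0 ≤ s) :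
    Tendsto (fun n => shiftOrSwapDefect n s) atTop (𝓝 (2 * √(2 * s) - 4 * Real.pi)) := by
  have hR := tendsto_one_sub_div_cube s
  have hp2 := tendsto_one_sub_pow s hs 1
  have hp : Tendsto (fun n : ℕ => (1 - s / (n : ℝ) ^ 3) ^ (n - 1)) atTop (𝓝 1) := by
    have := (tendsto_of_tendsto_mul (tendsto_natCast_pow_atTop (by norm_num)) hp2).const_sub 1
    simpa using this
  have hE : Tendsto (fun n : ℕ => ((1 - s / (n : ℝ) ^ 3) ^ (n - 1))⁻¹) atTop (𝓝 1) := by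
    simpa using hp.inv₀ one_ne_zero
  have hRinv : Tendsto (fun n : ℕ => (1 - s / (n : ℝ) ^ 3)⁻¹) atTop (𝓝 1) := by
    simpa using hR.inv₀ one_ne_zero
  have hcos : Tendsto (fun n : ℕ => (n : ℝ) ^ 2 * (1 - (2 + (1 - s / (n : ℝ) ^ 3)
      - (1 - s / (n : ℝ) ^ 3)⁻¹) * (1 - s / (n : ℝ) ^ 3) ^ (n - 1) / 2)) atTop (𝓝 s) := by
    -- `1 - cos ψ = (1 - P) + (1 - R) * (1 + 1 / R) * (P / 2)` with `P = R ^ (n - 1)`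
    have h1 := ((tendsto_sq_mul_div_cube s).mul (hRinv.const_add 1)).mul (hp.div_const 2)
    have h2 := hp2.add h1
    have e : s + 0 * (1 + 1) * (1 / 2) = s := by ring
    rw [e] at h2
    refine h2.congr' ?_
    filter_upwards [hR.eventually (lt_mem_nhds one_pos)] with n hn
    generalize (1 - s / (n : ℝ) ^ 3) ^ (n - 1) = P at *
    generalize s / (n : ℝ) ^ 3 = u at *
    field_simp
    ring
  obtain ⟨hψ, hsin⟩ := tendsto_mul_sin_arccos hcos
  have hsin2 := tendsto_mul_sin_div_sub hψ 1 (1 / 2)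
  have hy : Tendsto (fun n : ℕ => (2 * Real.pi - Real.arccos ((2 + (1 - s / (n : ℝ) ^ 3)
      - (1 - s / (n : ℝ) ^ 3)⁻¹) * (1 - s / (n : ℝ) ^ 3) ^ (n - 1) / 2)) / ((n : ℝ) - 1) / 2)
      atTop (𝓝 0) := by
    have h1 : Tendsto (fun n : ℕ => (n : ℝ) - 1) atTop atTop :=
      tendsto_atTop_add_const_right _ _ tendsto_natCast_atTop_atTop
    simpa using ((hψ.const_sub (2 * Real.pi)).div_atTop h1).div_const 2
  have hcosy := (Real.continuous_cos.tendsto 0).comp hy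
  rw [Real.cos_zero] at hcosy
  have h := (((hR.const_mul 2).mul hE).mul (hsin.mul hcosy)).sub
    (((hR.const_add 1).pow 2).mul hsin2)
  have e : 2 * 1 * 1 * (√(2 * s) * 1) - (1 + 1) ^ 2 * (1 / 2 * (2 * Real.pi))
      = 2 * √(2 * s) - 4 * Real.pi := by ring
  rw [e] at h
  refine h.congr fun n => ?_
  simp only [shiftOrSwapDefect, Function.comp, Nat.cast_one]
  rw [show ∀ a b : ℝ, 1 / 2 * a / b = a / b / 2 from fun a b => by ring]
  ring

theorem continuousOn_shiftOrSwapDefect {n : ℕ} {s₀ s₁ : ℝ} (h1 : s₁ < (n : ℝ) ^ 3) (h0 : 0 < s₀) :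
    ContinuousOn (shiftOrSwapDefect n) (Set.Icc s₀ s₁) := by
  have hR : ∀ s ∈ Set.Icc s₀ s₁, 1 - s / (n : ℝ) ^ 3 ≠ 0 := by
    intro s hs
    have : s / (n : ℝ) ^ 3 < 1 := (div_lt_one (by linarith [hs.1, hs.2])).2 (by linarith [hs.2])
    linarith
  have hRc : ContinuousOn (fun s : ℝ => 1 - s / (n : ℝ) ^ 3) (Set.Icc s₀ s₁) :=
    continuousOn_const.sub (continuousOn_id.div_const _)
  have hE : ContinuousOn (fun s : ℝ => ((1 - s / (n : ℝ) ^ 3) ^ (n - 1))⁻¹) (Set.Icc s₀ s₁) :=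
    (hRc.pow _).inv₀ fun s hs => pow_ne_zero _ (hR s hs)
  have hψ : ContinuousOn (fun s : ℝ => Real.arccos ((2 + (1 - s / (n : ℝ) ^ 3)
      - (1 - s / (n : ℝ) ^ 3)⁻¹) * (1 - s / (n : ℝ) ^ 3) ^ (n - 1) / 2)) (Set.Icc s₀ s₁) :=
    Real.continuous_arccos.comp_continuousOn
      ((((continuousOn_const.add hRc).sub (hRc.inv₀ hR)).mul (hRc.pow _)).div_const _)
  have hy := ((continuousOn_const (c := 2 * Real.pi).sub hψ).div_const ((n : ℝ) - 1)).div_const 2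
  exact continuousOn_const.mul (((((continuousOn_const.mul hRc).mul hE).mul
    (Real.continuous_sin.comp_continuousOn hψ)).mul (Real.continuous_cos.comp_continuousOn hy)).sub
      (((continuousOn_const.add hRc).pow 2).mul (Real.continuous_sin.comp_continuousOn hy)))

/-- The shift-or-swap shuffle has position eigenfunctions with `1 - ‖l‖ ~ π ^ 2 / n ^ 3`. -/
theorem eventually_exists_shiftOrSwap_eigenfunction {s₀ s₁ : ℝ} (h0 : 0 < s₀)
    (h0' : s₀ < 2 * Real.pi ^ 2) (h1 : 2 * Real.pi ^ 2 < s₁) :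
    ∀ᶠ n : ℕ in atTop, ∀ hn : 2 ≤ n,
      ∃ (τ : Fin 2 → Equiv.Perm (Fin n)) (w : Fin 2 → Circle) (g : Fin n → ℂ) (l : ℂ),
        shiftOrSwapStep hn = randomMove (fun j d => d * τ j) ∧
        IsPositionEigenfunction τ w g l (6 * (s₁ + 4 * Real.pi) + 5) ∧
        s₀ / 2 / n ^ 3 ≤ 1 - ‖l‖ ∧ 1 - ‖l‖ ≤ s₁ / 2 / n ^ 3 := by
  have hpi := Real.pi_pos
  have hs1 : 0 < s₁ := lt_trans (by positivity) h1
  have hsqrt : √(2 * (2 * Real.pi ^ 2)) = 2 * Real.pi := by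
    rw [show 2 * (2 * Real.pi ^ 2) = (2 * Real.pi) ^ 2 by ring, Real.sqrt_sq (by positivity)]
  have hroots := eventually_exists_eq_zero (F := shiftOrSwapDefect) (h0'.trans h1).le
    (by
      filter_upwards [(tendsto_natCast_pow_atTop (k := 3) (by norm_num)).eventually_gt_atTop s₁]
        with n hn using continuousOn_shiftOrSwapDefect hn h0)
    (tendsto_shiftOrSwapDefect h0.le)
    (by
      have := Real.sqrt_lt_sqrt (by positivity) (by linarith : 2 * s₀ < 2 * (2 * Real.pi ^ 2))
      linarith)
    (tendsto_shiftOrSwapDefect hs1.le)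
    (by
      have := Real.sqrt_lt_sqrt (by positivity) (by linarith : 2 * (2 * Real.pi ^ 2) < 2 * s₁)
      linarith)
  filter_upwards [hroots, eventually_ge_atTop 6,
    tendsto_natCast_atTop_atTop.eventually_ge_atTop (10 * s₁),
    tendsto_natCast_atTop_atTop.eventually_ge_atTop (4 * Real.pi)] with n hroot hn6 hns hnpi hn
  obtain ⟨s, ⟨hs0, hs1'⟩, hzero⟩ := hroot
  have hn6' : (6 : ℝ) ≤ n := by exact_mod_cast hn6
  have hspos : 0 < s := h0.trans_le hs0
  have hns' : 10 * s ≤ n := by linarith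
  have hR := one_sub_div_cube_pow_ge hspos.le hns' (by omega) (j := 1) (by omega)
  rw [pow_one] at hR
  simp only [shiftOrSwapDefect] at hzero
  have hu : 0 < s / (n : ℝ) ^ 3 := by positivity
  set R := 1 - s / (n : ℝ) ^ 3 with hRdef
  set ψ := Real.arccos ((2 + R - R⁻¹) * R ^ (n - 1) / 2) with hψ
  set y := (2 * Real.pi - ψ) / ((n : ℝ) - 1) with hy
  have hR0 : 0 < R := by linarith
  have hR1 : R ≤ 1 := by linarith
  have hψ0 : 0 ≤ ψ := Real.arccos_nonneg _
  have hψπ : ψ ≤ Real.pi := Real.arccos_le_pi _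
  have hRinv : R⁻¹ ≤ 2 := by
    rw [inv_le_comm₀ hR0 (by norm_num)]
    linarith
  have hRinv1 : 1 ≤ R⁻¹ := (one_le_inv₀ hR0).2 hR1
  have hP0 : 0 < R ^ (n - 1) := by positivity
  have hP1 : R ^ (n - 1) ≤ 1 := pow_le_one₀ hR0.le hR1
  have hcos : Real.cos ψ = (2 + R - R⁻¹) * R ^ (n - 1) / 2 := by
    have hprod0 : 0 ≤ (2 + R - R⁻¹) * R ^ (n - 1) := mul_nonneg (by linarith) hP0.le
    have hprod1 : (2 + R - R⁻¹) * R ^ (n - 1) ≤ 2 * 1 :=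
      mul_le_mul (by linarith) hP1 hP0.le (by norm_num)
    exact Real.cos_arccos (by linarith) (by linarith)
  have him : 2 * R * (R ^ (n - 1))⁻¹ * Real.sin ψ * Real.cos (y / 2)
      = (1 + R) ^ 2 * Real.sin (y / 2) := by
    rcases mul_eq_zero.1 hzero with h | h
    · linarith
    · linarith
  have hl := shiftOrSwap_root_of_polar hn hR0 rfl hcos hy him
  have hy0 : 0 ≤ y := div_nonneg (by linarith) (by linarith)
  have hyn : y ≤ 4 * Real.pi / n := by
    rw [hy, div_le_div_iff₀ (by linarith) (by linarith)]
    nlinarith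
  have hζ1 : ‖(Circle.exp y : ℂ) - 1‖ ≤ 4 * Real.pi / n := by
    rw [Circle.coe_exp, mul_comm]
    refine Real.norm_exp_I_mul_ofReal_sub_one_le.trans ?_
    rwa [Real.norm_eq_abs, abs_of_nonneg hy0]
  have hζ2 : 1 ≤ ‖1 + (Circle.exp y : ℂ)‖ := by
    have h2 := norm_sub_le (1 + (Circle.exp y : ℂ)) (Circle.exp y - 1)
    rw [show 1 + (Circle.exp y : ℂ) - (Circle.exp y - 1) = 2 by ring, Complex.norm_ofNat] at h2
    have h3 : 4 * Real.pi / n ≤ 1 := (div_le_one (by linarith)).2 hnpi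
    linarith
  have hnorm : ‖(1 + (R : ℂ)) / 2‖ = (1 + R) / 2 := by
    rw [norm_div, Complex.norm_ofNat, ← Complex.ofReal_one, ← Complex.ofReal_add,
      Complex.norm_real, Real.norm_eq_abs, abs_of_nonneg (by linarith)]
  have hgap : 1 - (1 + R) / 2 = s / 2 / (n : ℝ) ^ 3 := by
    rw [hRdef]
    ring
  refine ⟨_, _, _, _, ?_, isPositionEigenfunction_shiftOrSwap (by omega) (ζ := Circle.exp y)
    (ρ := Complex.exp (y * Complex.I) / R) ?_ ?_ hR hR1 (by positivity) ?_ ?_ hζ2, ?_, ?_⟩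
  · unfold shiftOrSwapStep
    congr 1
    funext j
    fin_cases j <;> rfl
  · rw [Circle.coe_exp]
    have : (R : ℂ) ≠ 0 := Complex.ofReal_ne_zero.2 hR0.ne'
    field_simp
  · rw [Circle.coe_exp]
    exact hl
  · rw [hRdef, sub_sub_cancel]
    gcongr
    linarith
  · refine hζ1.trans ?_
    gcongr
    linarith
  · rw [hnorm, hgap]
    gcongr
  · rw [hnorm, hgap]
    gcongr

end ShiftOrSwap

/-! ### The symmetrized Rudvalis shuffle -/

section SymmetrizedRudvalis

open Filter Topology

/-- The moves of the top card to the bottom and of the bottom card to the top carry the weights `ζ`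
and `ζ⁻¹`. In the rotated frame a position eigenfunction becomes a function `H` on a cycle of length
`n` with `H (x + 1) + H (x - 1) = c * H x` away from the pair of positions that can be exchanged,
here `n` (which stands for the top of the deck) and `1`. -/
theorem isPositionEigenfunction_symmetrizedRudvalis {n : ℕ} (hn : 3 ≤ n) {ζ : Circle} {H : ℕ → ℂ}
    {c : ℂ} {K : ℝ} (hζ : (ζ : ℂ) ^ n = 1) (hrec : ∀ x, H (x + 2) + H x = c * H (x + 1))
    (htop : H (n + 1) + H n = (1 + ζ) * H 1) (hsnd : H 0 + H 1 = (1 + (ζ : ℂ)⁻¹) * H n)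
    (hK : 0 ≤ K) (hζ1 : ‖(ζ : ℂ) - 1‖ ≤ K / n)
    (hdiff : ∀ x, 1 ≤ x → x < n → ‖H (x + 1) - H x‖ ≤ K / n ^ 2)
    (hjump : ‖H 1 - H n‖ ≤ K / n) (hlow : ∀ x, 1 ≤ x → x ≤ n → 1 / 2 ≤ ‖H x‖)
    (hup : ∀ x, 1 ≤ x → x ≤ n → ‖H x‖ ≤ K) :
    IsPositionEigenfunction
      ![Fin.cycleRange (⟨n - 1, by omega⟩ : Fin n), (Fin.cycleRange (⟨n - 1, by omega⟩ : Fin n))⁻¹,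
        Equiv.swap ⟨0, by omega⟩ ⟨1, by omega⟩, 1]
      ![ζ, ζ⁻¹, 1, 1] (fun p : Fin n => if p.val = 0 then H n else (ζ : ℂ) ^ p.val * H p.val)
      ((c + 2) / 4) (K + K ^ 2) := by
  have hζ0 : (ζ : ℂ) ≠ 0 := Circle.coe_ne_zero ζ
  have hζn : ‖(ζ : ℂ)‖ = 1 := Circle.norm_coe ζ
  have hζpow : ∀ (i : ℕ) (z : ℂ), ‖(ζ : ℂ) ^ i * z‖ = ‖z‖ := fun i z => by
    rw [norm_mul, norm_pow, hζn, one_pow, one_mul]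
  have v0 : ∀ p : Fin n, ((Fin.cycleRange (⟨n - 1, by omega⟩ : Fin n))⁻¹ p).val
      = if p.val = 0 then n - 1 else p.val - 1 := by
    intro p
    have hp := p.isLt
    rw [val_cycleRange_inv]
    simp only
    split_ifs <;> omega
  have v1 : ∀ p : Fin n, (((Fin.cycleRange (⟨n - 1, by omega⟩ : Fin n))⁻¹)⁻¹ p).val
      = if p.val + 1 = n then 0 else p.val + 1 := by
    intro p
    have hp := p.isLt
    rw [inv_inv, val_cycleRange]
    simp only
    split_ifs <;> omega
  have v2 : ∀ p : Fin n, ((Equiv.swap (⟨0, by omega⟩ : Fin n) ⟨1, by omega⟩)⁻¹ p).val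
      = if p.val = 0 then 1 else if p.val = 1 then 0 else p.val := by
    intro p
    rw [Equiv.swap_inv, val_swap_zero_one (by omega)]
  have v3 : ∀ p : Fin n, ((1 : Equiv.Perm (Fin n))⁻¹ p).val = p.val := fun p => by simp
  refine ⟨fun p => ?_, ?_, fun p => ?_, fun p => ?_⟩
  · have hp := p.isLt
    simp only [Fin.sum_univ_four, Matrix.cons_val, v0, v1, v2, v3, Circle.coe_one, one_mul,
      Circle.coe_inv]
    push_cast
    by_cases h0 : p.val = 0
    · obtain ⟨m, rfl⟩ := Nat.exists_eq_add_of_le' (by omega : 1 ≤ n)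
      have hr := hrec m
      simp only [h0, show m ≠ 0 by omega, show 0 + 1 ≠ m + 1 by omega, ↓reduceIte,
        zero_add, one_ne_zero, pow_one, Nat.add_sub_cancel]
      rw [pow_succ] at hζ
      rw [inv_mul_cancel_left₀ hζ0]
      linear_combination (1 / 4 : ℂ) * (H m * hζ + hr - htop)
    by_cases h1 : p.val = 1
    · have hr := hrec 0
      rw [zero_add, zero_add] at hr
      have hs : (ζ : ℂ) * (H 0 + H 1) = (1 + ζ) * H n := by
        rw [hsnd]
        field_simp
        ring
      have e : (ζ : ℂ)⁻¹ * ((ζ : ℂ) ^ 2 * H 2) = ζ * H 2 := by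
        field_simp
      simp only [h1, show 1 + 1 ≠ n by omega, ↓reduceIte, tsub_self, one_ne_zero, Nat.reduceAdd,
        two_ne_zero, pow_one]
      rw [e]
      linear_combination (1 / 4 : ℂ) * ζ * hr - (1 / 4 : ℂ) * hs
    · obtain ⟨q, hq⟩ := Nat.exists_eq_add_of_le' (by omega : 1 ≤ p.val)
      have hr := hrec q
      by_cases h2 : p.val + 1 = n
      · have hq2 : q + 2 = n := by omega
        have e : (ζ : ℂ)⁻¹ * H n = (ζ : ℂ) ^ (q + 1) * H (q + 2) := by
          rw [← hq2, pow_succ] at hζ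
          rw [hq2]
          field_simp
          linear_combination -(H n) * hζ
        simp only [h0, h1, h2, show p.val - 1 ≠ 0 by omega, ↓reduceIte]
        rw [e, hq, Nat.add_sub_cancel, pow_succ]
        linear_combination (1 / 4 : ℂ) * (ζ : ℂ) ^ q * ζ * hr
      · have e : (ζ : ℂ)⁻¹ * ((ζ : ℂ) ^ (q + 2) * H (q + 2)) = (ζ : ℂ) ^ (q + 1) * H (q + 2) := by
          rw [pow_succ]
          field_simp
        simp only [h0, h1, h2, show p.val - 1 ≠ 0 by omega, show p.val + 1 ≠ 0 by omega,
          ↓reduceIte]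
        rw [hq, Nat.add_sub_cancel, show q + 1 + 1 = q + 2 from rfl, e, pow_succ]
        linear_combination (1 / 4 : ℂ) * (ζ : ℂ) ^ q * ζ * hr
  · refine ⟨fun p => if p.val = 0 then H n else (ζ : ℂ) ^ p.val * H p.val, ?_⟩
    have hpos : 0 ≤ (K + K ^ 2) / (n : ℝ) ^ 2 := by positivity
    have hpos' : 0 ≤ (K + K ^ 2) / (n : ℝ) := by positivity
    have hone : K / (n : ℝ) ≤ (K + K ^ 2) / n := by
      gcongr
      nlinarith
    have htwo : K / (n : ℝ) ^ 2 ≤ (K + K ^ 2) / n ^ 2 := by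
      gcongr
      nlinarith
    have hdiff' : ∀ x, 1 ≤ x → x < n → ‖H x - H (x + 1)‖ ≤ K / n ^ 2 := fun x h1 h2 => by
      rw [norm_sub_rev]
      exact hdiff x h1 h2
    have hswap : ‖(ζ : ℂ) * H 1 - H n‖ ≤ (K + K ^ 2) / n := by
      have e : (ζ : ℂ) * H 1 - H n = (ζ : ℂ) ^ 1 * (H 1 - H n) + (ζ - 1) * H n := by ring
      rw [e]
      refine (norm_add_le _ _).trans ?_
      rw [hζpow, norm_mul]
      have h1 : ‖(ζ : ℂ) - 1‖ * ‖H n‖ ≤ K / n * K :=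
        mul_le_mul hζ1 (hup n (by omega) le_rfl) (norm_nonneg _) (by positivity)
      have h2 : (K + K ^ 2) / n = K / n + K / n * K := by ring
      linarith
    intro j p
    have hp := p.isLt
    revert j
    simp only [Fin.forall_fin_succ, Matrix.cons_val_zero,
      Matrix.cons_val_succ, v0, v1, v2, v3, Circle.coe_one, one_mul, Circle.coe_inv]
    refine ⟨?_, ?_, ?_, ?_, fun j => j.elim0⟩
    · by_cases h0 : p.val = 0
      · rw [if_pos h0, if_pos h0, if_neg (by omega), if_pos (by omega), ← mul_assoc, ← pow_succ',
          show n - 1 + 1 = n by omega, hζ, one_mul]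
        have := hdiff' (n - 1) (by omega) (by omega)
        rw [show n - 1 + 1 = n by omega] at this
        linarith
      rw [if_neg h0, if_neg h0]
      by_cases h1 : p.val = 1
      · rw [if_pos (by omega), if_pos (by omega), h1, pow_one, ← mul_sub, norm_mul, hζn, one_mul,
          norm_sub_rev]
        linarith
      · rw [if_neg (by omega), ← mul_assoc, ← pow_succ', show p.val - 1 + 1 = p.val by omega,
          ← mul_sub, hζpow]
        have := hdiff' (p.val - 1) (by omega) (by omega)
        rw [show p.val - 1 + 1 = p.val by omega] at this
        split_ifs <;> linarith
    · by_cases h0 : p.val = 0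
      · simp only [h0, show 0 + 1 ≠ n by omega, ↓reduceIte, zero_add, one_ne_zero, pow_one,
          zero_le, true_or]
        rw [inv_mul_cancel_left₀ hζ0]
        linarith
      rw [if_neg h0]
      by_cases h1 : p.val + 1 = n
      · rw [if_pos h1, if_pos rfl, if_pos (by omega)]
        have e : (ζ : ℂ)⁻¹ * H n = (ζ : ℂ) ^ p.val * H (p.val + 1) := by
          rw [← h1, pow_succ] at hζ
          rw [h1]
          field_simp
          linear_combination -(H n) * hζ
        rw [e, ← mul_sub, hζpow]
        have := hdiff p.val (by omega) (by omega)
        linarith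
      · rw [if_neg h1, if_neg (by omega)]
        have e : (ζ : ℂ)⁻¹ * ((ζ : ℂ) ^ (p.val + 1) * H (p.val + 1))
            = (ζ : ℂ) ^ p.val * H (p.val + 1) := by
          rw [pow_succ]
          field_simp
        rw [e, ← mul_sub, hζpow]
        have := hdiff p.val (by omega) (by omega)
        split_ifs <;> linarith
    · by_cases h0 : p.val = 0
      · rw [if_pos h0, if_pos h0, if_neg (by omega), if_pos (by omega), pow_one]
        linarith
      rw [if_neg h0, if_neg h0]
      by_cases h1 : p.val = 1
      · rw [if_pos h1, if_pos rfl, if_pos (by omega), h1, pow_one, norm_sub_rev]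
        linarith
      · rw [if_neg h1, if_neg h0, sub_self, norm_zero]
        split_ifs <;> linarith
    · refine (norm_le_zero_iff.2 (sub_eq_zero.2 rfl)).trans ?_
      split_ifs <;> linarith
  · have hp := p.isLt
    split_ifs with h
    · exact hlow n (by omega) le_rfl
    · rw [hζpow]
      exact hlow _ (by omega) (by omega)
  · have hp := p.isLt
    have : 0 ≤ K ^ 2 := by positivity
    split_ifs with h
    · linarith [hup n (by omega) le_rfl]
    · rw [hζpow]
      linarith [hup p.val (by omega) (by omega)]

/-- The amplitude of the odd part of `H` is forced by the imaginary part of the boundary condition,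
and then the real part of that condition is the equation `h` for the eigenvalue. -/
theorem symmetrizedRudvalis_boundary {P q t β : ℝ}
    (h : Real.cos t ^ 2 * Real.cos (P - 2 * q) = Real.cos P * Real.cos q ^ 2)
    (hden : Real.sin P * Real.cos q + Real.cos t ^ 2 * Real.sin (P - q) ≠ 0)
    (hβ : β = Real.sin t * Real.cos t * Real.cos (P - q)
      / (Real.sin P * Real.cos q + Real.cos t ^ 2 * Real.sin (P - q))) :
    Real.cos (P + q) + Real.cos (P - q)
        = 2 * (Real.cos t ^ 2 * Real.cos (P - q) + Real.sin t * Real.cos t * β * Real.sin (P - q)) ∧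
      β * Real.sin (P + q) + β * Real.sin (P - q)
        = 2 * (Real.sin t * Real.cos t * Real.cos (P - q)
          - Real.cos t ^ 2 * β * Real.sin (P - q)) := by
  have him : β * (Real.sin P * Real.cos q + Real.cos t ^ 2 * Real.sin (P - q))
      = Real.sin t * Real.cos t * Real.cos (P - q) := by
    rw [hβ]
    field_simp
  have hsum : Real.cos (P + q) + Real.cos (P - q) = 2 * (Real.cos P * Real.cos q) := by
    rw [Real.cos_add, Real.cos_sub]
    ring
  have hsum' : Real.sin (P + q) + Real.sin (P - q) = 2 * (Real.sin P * Real.cos q) := by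
    rw [Real.sin_add, Real.sin_sub]
    ring
  constructor
  · rw [hsum]
    refine congrArg (2 * ·) (mul_right_cancel₀ hden ?_)
    have key : Real.cos (P - q) * Real.sin (P - q) + Real.sin P * Real.cos q * Real.cos (P - q)
        - Real.cos P * Real.cos q * Real.sin (P - q) = Real.sin P * Real.cos (P - 2 * q) := by
      rw [Real.cos_sub, Real.sin_sub, Real.cos_sub, Real.cos_two_mul, Real.sin_two_mul]
      linear_combination -(Real.cos P * Real.sin P) * Real.sin_sq_add_cos_sq q
    have ht := Real.sin_sq_add_cos_sq t
    linear_combination -(Real.sin P) * h + Real.cos t ^ 2 * (-key)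
      - Real.sin t * Real.cos t * Real.sin (P - q) * him
      - Real.cos t ^ 2 * Real.cos (P - q) * Real.sin (P - q) * ht
  · linear_combination β * hsum' + 2 * him

/-- The eigenvalue equation of the symmetrized Rudvalis shuffle, for the eigenvalue
`cos (θ / 2) ^ 2` with `θ ^ 2 = s / n ^ 3`: the difference of its two sides, scaled by `n ^ 2`. -/
noncomputable def symmetrizedRudvalisDefect (n : ℕ) (s : ℝ) : ℝ :=
  let θ := √(s / (n : ℝ) ^ 3)
  (n : ℝ) ^ 2 * (Real.cos (Real.pi / n) ^ 2 * Real.cos (θ * n / 2 - 2 * (θ / 2))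
    - Real.cos (θ * n / 2) * Real.cos (θ / 2) ^ 2)

theorem tendsto_symmetrizedRudvalisDefect {s : ℝ} (hs : 0 ≤ s) :
    Tendsto (fun n => symmetrizedRudvalisDefect n s) atTop (𝓝 (s / 2 - Real.pi ^ 2)) := by
  set θ : ℕ → ℝ := fun n => √(s / (n : ℝ) ^ 3) with hθ
  have hθsq : ∀ n, θ n ^ 2 = s / (n : ℝ) ^ 3 := fun n => Real.sq_sqrt (by positivity)
  have hθn : Tendsto (fun n : ℕ => (n : ℝ) * θ n) atTop (𝓝 0) := by
    have h1 : Tendsto (fun n : ℕ => √(s / (n : ℝ))) atTop (𝓝 0) := by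
      have := (tendsto_natCast_atTop_atTop (R := ℝ)).const_div_atTop s |>.sqrt
      rwa [Real.sqrt_zero] at this
    refine h1.congr' ?_
    filter_upwards [eventually_gt_atTop 0] with n hn
    have hn' : (0 : ℝ) < n := Nat.cast_pos.2 hn
    rw [Real.sqrt_eq_iff_eq_sq (by positivity) (by positivity), mul_pow, hθsq]
    field_simp
  have hθ0 := tendsto_of_tendsto_mul tendsto_natCast_atTop_atTop hθn
  have hP : Tendsto (fun n : ℕ => θ n * n / 2) atTop (𝓝 0) := by
    have := hθn.div_const 2
    rw [zero_div] at this
    refine this.congr fun n => ?_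
    ring
  have hq : Tendsto (fun n : ℕ => θ n / 2) atTop (𝓝 0) := by simpa using hθ0.div_const 2
  have hPq : Tendsto (fun n : ℕ => θ n * n / 2 - θ n / 2) atTop (𝓝 0) := by
    simpa using hP.sub hq
  have hP2q : Tendsto (fun n : ℕ => θ n * n / 2 - 2 * (θ n / 2)) atTop (𝓝 0) := by
    simpa using hP.sub (hq.const_mul 2)
  have hcosP := (Real.continuous_cos.tendsto 0).comp hP
  have hcosP2q := (Real.continuous_cos.tendsto 0).comp hP2q
  rw [Real.cos_zero] at hcosP hcosP2q
  have hquad : Tendsto (fun n : ℕ => (n : ℝ) ^ 2 * (θ n * n / 2 - θ n / 2) * (θ n / 2)) atTop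
      (𝓝 (s / 4)) := by
    have h1 : Tendsto (fun n : ℕ => s / 4 - s / 4 / (n : ℝ)) atTop (𝓝 (s / 4 - 0)) :=
      tendsto_const_nhds.sub (tendsto_natCast_atTop_atTop.const_div_atTop _)
    rw [sub_zero] at h1
    refine h1.congr' ?_
    filter_upwards [eventually_gt_atTop 0] with n hn
    have hn' : (0 : ℝ) < n := Nat.cast_pos.2 hn
    have e : (n : ℝ) ^ 2 * (θ n * n / 2 - θ n / 2) * (θ n / 2)
        = (n : ℝ) ^ 2 * ((n - 1) / 4) * θ n ^ 2 := by ring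
    rw [e, hθsq]
    field_simp
  have hsin1 := tendsto_mul_sin hquad hq
  have hsin2 : Tendsto (fun n : ℕ => (n : ℝ) ^ 2 * Real.sin (θ n / 2)
      * Real.sin (θ n * n / 2 - θ n / 2)) atTop (𝓝 (s / 4)) := by
    refine tendsto_mul_sin (hsin1.congr fun n => ?_) hPq
    ring
  have hpi : Tendsto (fun n : ℕ => (n : ℝ) * Real.sin (Real.pi / n)) atTop (𝓝 Real.pi) := by
    refine tendsto_mul_sin ((tendsto_div_sub Real.pi 0).congr fun n => ?_)
      (tendsto_natCast_atTop_atTop.const_div_atTop _)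
    rw [Nat.cast_zero, sub_zero]
  have hsmall : Tendsto (fun n : ℕ => (n : ℝ) * Real.sin (θ n / 2)) atTop (𝓝 0) := by
    refine tendsto_mul_sin ?_ hq
    have := hθn.div_const 2
    rw [zero_div] at this
    refine this.congr fun n => ?_
    ring
  have h := ((hsin2.const_mul 2).sub ((hpi.pow 2).mul hcosP2q)).add (hcosP.mul (hsmall.pow 2))
  have e : 2 * (s / 4) - Real.pi ^ 2 * 1 + 1 * 0 ^ 2 = s / 2 - Real.pi ^ 2 := by ring
  rw [e] at h
  refine h.congr fun n => ?_
  have hc := Real.cos_sub_cos (θ n * n / 2 - 2 * (θ n / 2)) (θ n * n / 2)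
  rw [show (θ n * n / 2 - 2 * (θ n / 2) + θ n * n / 2) / 2 = θ n * n / 2 - θ n / 2 by ring,
    show (θ n * n / 2 - 2 * (θ n / 2) - θ n * n / 2) / 2 = -(θ n / 2) by ring, Real.sin_neg] at hc
  have h1 := Real.sin_sq_add_cos_sq (Real.pi / n)
  have h2 := Real.sin_sq_add_cos_sq (θ n / 2)
  simp only [symmetrizedRudvalisDefect, Function.comp]
  change _ = (n : ℝ) ^ 2 * (Real.cos (Real.pi / n) ^ 2 * Real.cos (θ n * n / 2 - 2 * (θ n / 2))
    - Real.cos (θ n * n / 2) * Real.cos (θ n / 2) ^ 2)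
  linear_combination -(n : ℝ) ^ 2 * hc
    - (n : ℝ) ^ 2 * Real.cos (θ n * n / 2 - 2 * (θ n / 2)) * h1
    + (n : ℝ) ^ 2 * Real.cos (θ n * n / 2) * h2

theorem continuous_symmetrizedRudvalisDefect (n : ℕ) :
    Continuous (symmetrizedRudvalisDefect n) := by
  have hθ : Continuous fun s : ℝ => √(s / (n : ℝ) ^ 3) :=
    Real.continuous_sqrt.comp (continuous_id.div_const _)
  have hP := (hθ.mul (continuous_const (y := (n : ℝ)))).div_const 2
  have hq := hθ.div_const 2
  exact continuous_const.mul ((continuous_const.mul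
    (Real.continuous_cos.comp (hP.sub (continuous_const.mul hq)))).sub
      ((Real.continuous_cos.comp hP).mul ((Real.continuous_cos.comp hq).pow 2)))

/-- The amplitude `β` of `symmetrizedRudvalis_boundary` is at most of order `1 / (n * P)`. -/
theorem symmetrizedRudvalis_amplitude {n : ℕ} (hn : 6 ≤ n) {P q t β : ℝ} (hq : 0 < q)
    (hP : P = q * n) (hP1 : P ≤ 1 / 2) (ht : t = Real.pi / n)
    (hβ : β = Real.sin t * Real.cos t * Real.cos (P - q)
      / (Real.sin P * Real.cos q + Real.cos t ^ 2 * Real.sin (P - q))) :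
    0 < Real.sin P * Real.cos q + Real.cos t ^ 2 * Real.sin (P - q) ∧ 0 ≤ β ∧
      0 ≤ Real.sin (P - q) ∧ β * Real.sin (P - q) ≤ 2 * Real.pi / n ∧
      β * (2 * q) ≤ 4 * Real.pi ^ 2 / n ^ 2 := by
  have hpi := Real.pi_pos
  have hpi3 := Real.pi_gt_three
  have hn6' : (6 : ℝ) ≤ n := by exact_mod_cast hn
  have hn0 : (0 : ℝ) < n := by linarith
  have hqP : 6 * q ≤ P := by rw [hP]; nlinarith
  have hPqpos : 0 < P - q := by linarith
  have htpos : 0 < t := by rw [ht]; positivity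
  have ht1 : t ≤ 1 := by
    rw [ht, div_le_one hn0]
    linarith [Real.pi_le_four]
  have hct : 1 / 2 ≤ Real.cos t := half_le_cos (by rw [abs_of_pos htpos]; exact ht1)
  have hS : 0 < Real.sin (P - q) := Real.sin_pos_of_pos_of_lt_pi hPqpos (by linarith)
  have hb : 0 ≤ Real.sin P * Real.cos q := by
    refine mul_nonneg (Real.sin_nonneg_of_nonneg_of_le_pi (by linarith) (by linarith)) ?_
    have := half_le_cos (x := q) (by rw [abs_of_pos hq]; linarith)
    linarith
  have hst : 0 ≤ Real.sin t := Real.sin_nonneg_of_nonneg_of_le_pi htpos.le (by linarith)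
  have hstt : Real.sin t ≤ t := Real.sin_le htpos.le
  have hden : 0 < Real.sin P * Real.cos q + Real.cos t ^ 2 * Real.sin (P - q) := by positivity
  have hC0 : 0 ≤ Real.cos (P - q) := by
    have := half_le_cos (x := P - q) (by rw [abs_of_pos hPqpos]; linarith)
    linarith
  have hβ0 : 0 ≤ β := by rw [hβ]; positivity
  have hβS : β * Real.sin (P - q) ≤ 2 * Real.pi / n := by
    have e1 : β * (Real.sin P * Real.cos q + Real.cos t ^ 2 * Real.sin (P - q))
        = Real.sin t * Real.cos t * Real.cos (P - q) := by
      rw [hβ]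
      field_simp
    have h2 : 0 ≤ β * (Real.sin P * Real.cos q) := by positivity
    have h3 : Real.sin t * Real.cos t * Real.cos (P - q) ≤ Real.sin t * Real.cos t * 1 :=
      mul_le_mul_of_nonneg_left (Real.cos_le_one _) (by positivity)
    have h4 : Real.cos t * (Real.cos t * (β * Real.sin (P - q))) ≤ Real.cos t * Real.sin t := by
      linarith
    have h5 := le_of_mul_le_mul_left h4 (by linarith)
    have h6 : 0 ≤ β * Real.sin (P - q) := by positivity
    have h7 : 2 * Real.pi / n = 2 * t := by rw [ht]; ring
    have h8 := mul_le_mul_of_nonneg_right hct h6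
    rw [h7]
    linarith
  refine ⟨hden, hβ0, hS.le, hβS, ?_⟩
  have h2 := Real.mul_le_sin hPqpos.le (by linarith)
  have h3 : q * n ≤ Real.pi * Real.sin (P - q) := by
    have h4 : 2 / Real.pi * (P - q) * Real.pi = 2 * (P - q) := by field_simp
    have h5 := mul_le_mul_of_nonneg_right h2 hpi.le
    rw [h4] at h5
    linarith
  rw [le_div_iff₀ (by positivity)]
  rw [le_div_iff₀ hn0] at hβS
  have h6 := mul_le_mul_of_nonneg_left h3 (mul_nonneg hβ0 hn0.le)
  have h7 := mul_le_mul_of_nonneg_left hβS hpi.le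
  linarith

/-- The solution of the recurrence, with even part `cos` and odd part `β * sin` about the midpoint
of `1, …, n`, yields a position eigenfunction. -/
theorem exists_symmetrizedRudvalis_eigenfunction {n : ℕ} (hn : 6 ≤ n) {q s : ℝ} (hq : 0 < q)
    (hP1 : q * n ≤ 1 / 2) (hs : 4 * q ^ 2 * n ^ 3 ≤ s)
    (hroot : Real.cos (Real.pi / n) ^ 2 * Real.cos (q * n - 2 * q)
      = Real.cos (q * n) * Real.cos q ^ 2) {K : ℝ}
    (hK : K = s + 4 * Real.pi ^ 2 + 4 * Real.pi + 1) :
    ∃ (ζ : Circle) (g : Fin n → ℂ), IsPositionEigenfunction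
      ![Fin.cycleRange (⟨n - 1, by omega⟩ : Fin n), (Fin.cycleRange (⟨n - 1, by omega⟩ : Fin n))⁻¹,
        Equiv.swap ⟨0, by omega⟩ ⟨1, by omega⟩, 1]
      ![ζ, ζ⁻¹, 1, 1] g ((((2 * Real.cos (2 * q) : ℝ) : ℂ) + 2) / 4) (K + K ^ 2) := by
  have hpi := Real.pi_pos
  have hn6' : (6 : ℝ) ≤ n := by exact_mod_cast hn
  have hn0 : (0 : ℝ) < n := by linarith
  have hs0 : 0 ≤ s := le_trans (by positivity) hs
  obtain ⟨P, hP⟩ : ∃ P, P = q * n := ⟨_, rfl⟩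
  obtain ⟨t, ht⟩ : ∃ t, t = Real.pi / n := ⟨_, rfl⟩
  obtain ⟨β, hβ⟩ : ∃ β, β = Real.sin t * Real.cos t * Real.cos (P - q)
      / (Real.sin P * Real.cos q + Real.cos t ^ 2 * Real.sin (P - q)) := ⟨_, rfl⟩
  rw [← hP] at hP1
  rw [← hP, ← ht] at hroot
  obtain ⟨hden, hβ0, hS0, hβS, hβθ⟩ := symmetrizedRudvalis_amplitude hn hq hP hP1 ht hβ
  obtain ⟨hre1, him1⟩ := symmetrizedRudvalis_boundary hroot hden.ne' hβ
  have htpos : 0 < t := by rw [ht]; positivity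
  let u : ℕ → ℝ := fun x => 2 * q * (x - ((n : ℝ) + 1) / 2)
  let H : ℕ → ℂ := fun x => ⟨Real.cos (u x), β * Real.sin (u x)⟩
  have hre : ∀ x, (H x).re = Real.cos (u x) := fun x => rfl
  have him : ∀ x, (H x).im = β * Real.sin (u x) := fun x => rfl
  have hu0 : u 0 = -(P + q) := by simp only [u, hP]; push_cast; ring
  have hu1 : u 1 = -(P - q) := by simp only [u, hP]; push_cast; ring
  have hun : u n = P - q := by simp only [u, hP]; ring
  have hun1 : u (n + 1) = P + q := by simp only [u, hP]; push_cast; ring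
  have hustep : ∀ x, u (x + 1) = u x + 2 * q := fun x => by simp only [u]; push_cast; ring
  have humono : Monotone u := monotone_nat_of_le_succ fun x => by rw [hustep]; linarith
  have hubound : ∀ x, 1 ≤ x → x ≤ n → |u x| ≤ P - q := by
    intro x hx1 hxn
    rw [abs_le, ← hu1, ← hun]
    exact ⟨humono hx1, humono hxn⟩
  clear_value u
  obtain ⟨ζ, hζ⟩ : ∃ ζ, ζ = Circle.exp (2 * t) := ⟨_, rfl⟩
  have hζre : (ζ : ℂ).re = Real.cos (2 * t) := by
    rw [hζ, Circle.coe_exp, Complex.exp_ofReal_mul_I_re]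
  have hζim : (ζ : ℂ).im = Real.sin (2 * t) := by
    rw [hζ, Circle.coe_exp, Complex.exp_ofReal_mul_I_im]
  have hinvre : ((ζ : ℂ)⁻¹).re = Real.cos (2 * t) := by
    rw [← Circle.coe_inv, hζ, ← Circle.exp_neg, Circle.coe_exp, Complex.exp_ofReal_mul_I_re,
      Real.cos_neg]
  have hinvim : ((ζ : ℂ)⁻¹).im = -Real.sin (2 * t) := by
    rw [← Circle.coe_inv, hζ, ← Circle.exp_neg, Circle.coe_exp, Complex.exp_ofReal_mul_I_im,
      Real.sin_neg]
  have hcos2 := Real.cos_two_mul t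
  have hsin2 := Real.sin_two_mul t
  have hnorm_le : ∀ z : ℂ, ‖z‖ ≤ |z.re| + |z.im| := Complex.norm_le_abs_re_add_abs_im
  have hK0 : 0 ≤ K := by rw [hK]; positivity
  have hK4 : 4 * Real.pi ≤ K := by rw [hK]; nlinarith
  refine ⟨ζ, _, isPositionEigenfunction_symmetrizedRudvalis (by omega) (H := H)
    ?_ ?_ ?_ ?_ hK0 ?_ ?_ ?_ ?_ ?_⟩
  · rw [← Circle.coe_pow, hζ, ← Circle.exp_nsmul, nsmul_eq_mul, ht,
      show (n : ℝ) * (2 * (Real.pi / n)) = 2 * Real.pi by field_simp, Circle.exp_two_pi,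
      Circle.coe_one]
  · intro x
    have e1 : u x = u (x + 1) - 2 * q := by rw [hustep]; ring
    have e2 : u (x + 2) = u (x + 1) + 2 * q := hustep (x + 1)
    apply Complex.ext
    · rw [Complex.re_ofReal_mul, Complex.add_re, hre, hre, hre, e1, e2, Real.cos_add, Real.cos_sub]
      ring
    · rw [Complex.im_ofReal_mul, Complex.add_im, him, him, him, e1, e2, Real.sin_add, Real.sin_sub]
      ring
  · apply Complex.ext
    · simp only [Complex.add_re, Complex.mul_re, Complex.one_re, Complex.add_im, Complex.one_im,
        hre, him, hζre, hζim, hun1, hun, hu1, Real.cos_neg, Real.sin_neg]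
      linear_combination hre1 - Real.cos (P - q) * hcos2 - β * Real.sin (P - q) * hsin2
    · simp only [Complex.add_im, Complex.mul_im, Complex.one_re, Complex.add_re, Complex.one_im,
        hre, him, hζre, hζim, hun1, hun, hu1, Real.cos_neg, Real.sin_neg]
      linear_combination him1 + β * Real.sin (P - q) * hcos2 - Real.cos (P - q) * hsin2
  · apply Complex.ext
    · simp only [Complex.add_re, Complex.mul_re, Complex.one_re, Complex.add_im, Complex.one_im,
        hre, him, hinvre, hinvim, hu0, hun, hu1, Real.cos_neg]
      linear_combination hre1 - Real.cos (P - q) * hcos2 - β * Real.sin (P - q) * hsin2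
    · simp only [Complex.add_im, Complex.mul_im, Complex.one_re, Complex.add_re, Complex.one_im,
        hre, him, hinvre, hinvim, hu0, hun, hu1, Real.sin_neg]
      linear_combination -him1 - β * Real.sin (P - q) * hcos2 + Real.cos (P - q) * hsin2
  · rw [hζ, Circle.coe_exp, mul_comm]
    refine Real.norm_exp_I_mul_ofReal_sub_one_le.trans ?_
    rw [Real.norm_eq_abs, abs_of_pos (by positivity), ht, mul_div_assoc']
    gcongr
    linarith
  · intro x hx1 hxn
    refine (hnorm_le _).trans ?_
    rw [Complex.sub_re, Complex.sub_im, hre, hre, him, him, ← mul_sub, abs_mul, abs_of_nonneg hβ0]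
    have hsin : |Real.sin (u (x + 1)) - Real.sin (u x)| ≤ 2 * q := by
      have h2 := Real.abs_sin_sub_sin_le (u (x + 1)) (u x)
      have h3 : |u (x + 1) - u x| = 2 * q := by
        rw [hustep, add_sub_cancel_left, abs_of_pos (by positivity)]
      rwa [h3] at h2
    have hcosd : |Real.cos (u (x + 1)) - Real.cos (u x)| ≤ s / n ^ 2 := by
      have h4 : |(-2 : ℝ)| = 2 := by norm_num
      rw [Real.cos_sub_cos, hustep, show (u x + 2 * q - u x) / 2 = q by ring, abs_mul, abs_mul, h4]
      have h2 : |Real.sin q| ≤ q := by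
        have := Real.abs_sin_le_abs (x := q)
        rwa [abs_of_pos hq] at this
      have h3 : |Real.sin ((u x + 2 * q + u x) / 2)| ≤ P := by
        refine Real.abs_sin_le_abs.trans ?_
        rw [show (u x + 2 * q + u x) / 2 = u x + q by ring]
        refine (abs_add_le _ _).trans ?_
        have := hubound x hx1 hxn.le
        rw [abs_of_pos hq]
        linarith
      have h5 : 0 ≤ P := by rw [hP]; positivity
      calc 2 * |Real.sin ((u x + 2 * q + u x) / 2)| * |Real.sin q| ≤ 2 * P * q := by gcongr
        _ = (2 * q ^ 2 * n ^ 3) / n ^ 2 := by rw [hP]; field_simp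
        _ ≤ s / n ^ 2 := by
          gcongr
          have : 0 ≤ q ^ 2 * (n : ℝ) ^ 3 := by positivity
          linarith
    have hfin : s / (n : ℝ) ^ 2 + 4 * Real.pi ^ 2 / n ^ 2 ≤ K / n ^ 2 := by
      rw [← add_div]
      gcongr
      linarith
    have := mul_le_mul_of_nonneg_left hsin hβ0
    linarith
  · refine (hnorm_le _).trans ?_
    rw [Complex.sub_re, Complex.sub_im, hre, hre, him, him, hu1, hun, Real.cos_neg, Real.sin_neg,
      sub_self, abs_zero, zero_add,
      show β * -Real.sin (P - q) - β * Real.sin (P - q) = -(2 * (β * Real.sin (P - q))) by ring,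
      abs_neg, abs_of_nonneg (by positivity)]
    calc 2 * (β * Real.sin (P - q)) ≤ 2 * (2 * Real.pi / n) := by gcongr
      _ = 4 * Real.pi / n := by ring
      _ ≤ K / n := by gcongr
  · intro x hx1 hxn
    have h2 := half_le_cos ((hubound x hx1 hxn).trans (by linarith))
    refine h2.trans ?_
    rw [← hre]
    exact Complex.re_le_norm _
  · intro x hx1 hxn
    refine (hnorm_le _).trans ?_
    rw [hre, him, abs_mul, abs_of_nonneg hβ0]
    have h2 : |Real.sin (u x)| ≤ 2 * q * n := by
      refine Real.abs_sin_le_abs.trans ((hubound x hx1 hxn).trans ?_)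
      have : 0 < q * n := by positivity
      linarith
    have h3 : β * |Real.sin (u x)| ≤ 4 * Real.pi ^ 2 := by
      calc β * |Real.sin (u x)| ≤ β * (2 * q * n) := by gcongr
        _ = β * (2 * q) * n := by ring
        _ ≤ 4 * Real.pi ^ 2 / n ^ 2 * n := by gcongr
        _ = 4 * Real.pi ^ 2 / n := by field_simp
        _ ≤ 4 * Real.pi ^ 2 := div_le_self (by positivity) (by linarith)
    linarith [Real.abs_cos_le_one (u x)]

/-- The symmetrized Rudvalis shuffle has position eigenfunctions with
`1 - ‖l‖ ~ π ^ 2 / (2 * n ^ 3)`. -/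
theorem eventually_exists_symmetrizedRudvalis_eigenfunction {s₀ s₁ : ℝ} (h0 : 0 < s₀)
    (h0' : s₀ < 2 * Real.pi ^ 2) (h1 : 2 * Real.pi ^ 2 < s₁) :
    ∃ K : ℝ, ∀ᶠ n : ℕ in atTop, ∀ hn : 2 ≤ n,
      ∃ (τ : Fin 4 → Equiv.Perm (Fin n)) (w : Fin 4 → Circle) (g : Fin n → ℂ) (l : ℂ),
        symmetrizedRudvalisStep hn = randomMove (fun j d => d * τ j) ∧
        IsPositionEigenfunction τ w g l K ∧
        s₀ / Real.pi ^ 2 / n ^ 3 ≤ 1 - ‖l‖ ∧ 1 - ‖l‖ ≤ s₁ / 4 / n ^ 3 := by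
  have hpi := Real.pi_pos
  have hs1 : 0 < s₁ := lt_trans (by positivity) h1
  obtain ⟨K, hK⟩ : ∃ K, K = s₁ + 4 * Real.pi ^ 2 + 4 * Real.pi + 1 := ⟨_, rfl⟩
  refine ⟨K + K ^ 2, ?_⟩
  have hroots := eventually_exists_eq_zero (F := symmetrizedRudvalisDefect) (h0'.trans h1).le
    (Eventually.of_forall fun n => (continuous_symmetrizedRudvalisDefect n).continuousOn)
    (tendsto_symmetrizedRudvalisDefect h0.le) (by linarith)
    (tendsto_symmetrizedRudvalisDefect hs1.le) (by linarith)
  filter_upwards [hroots, eventually_ge_atTop 6,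
    tendsto_natCast_atTop_atTop.eventually_ge_atTop s₁] with n hroot hn6 hns hn
  obtain ⟨s, ⟨hs0, hs1'⟩, hzero⟩ := hroot
  have hn6' : (6 : ℝ) ≤ n := by exact_mod_cast hn6
  have hn0 : (0 : ℝ) < n := by linarith
  have hspos : 0 < s := h0.trans_le hs0
  simp only [symmetrizedRudvalisDefect] at hzero
  obtain ⟨q, hq⟩ : ∃ q, q = √(s / (n : ℝ) ^ 3) / 2 := ⟨_, rfl⟩
  have hqpos : 0 < q := by
    have := Real.sqrt_pos.2 (by positivity : 0 < s / (n : ℝ) ^ 3)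
    rw [hq]
    linarith
  have hqsq : q ^ 2 = s / 4 / (n : ℝ) ^ 3 := by
    rw [hq, div_pow, Real.sq_sqrt (by positivity)]
    ring
  have hqn : q * n ≤ 1 / 2 := by
    have h2 : (q * n) ^ 2 ≤ (1 / 2) ^ 2 := by
      rw [mul_pow, hqsq]
      have e : s / 4 / (n : ℝ) ^ 3 * n ^ 2 = s / n * (1 / 2) ^ 2 := by
        field_simp
        norm_num
      rw [e]
      refine mul_le_of_le_one_left (by positivity) ((div_le_one hn0).2 (by linarith))
    exact (pow_le_pow_iff_left₀ (by positivity) (by norm_num) two_ne_zero).1 h2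
  have hqs : 4 * q ^ 2 * (n : ℝ) ^ 3 ≤ s₁ := by
    rw [hqsq]
    have e : 4 * (s / 4 / (n : ℝ) ^ 3) * n ^ 3 = s := by field_simp
    linarith
  have hroot : Real.cos (Real.pi / n) ^ 2 * Real.cos (q * n - 2 * q)
      = Real.cos (q * n) * Real.cos q ^ 2 := by
    rw [← hq, mul_div_right_comm, ← hq] at hzero
    rcases mul_eq_zero.1 hzero with h | h
    · exact absurd h (by positivity)
    · linarith
  have hlnorm : ‖(((2 * Real.cos (2 * q) : ℝ) : ℂ) + 2) / 4‖ = 1 - Real.sin q ^ 2 := by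
    have h2 : 2 * Real.cos (2 * q) = 4 * (1 - Real.sin q ^ 2) - 2 := by
      rw [Real.cos_two_mul, Real.sin_sq]
      ring
    have h3 : (((2 * Real.cos (2 * q) : ℝ) : ℂ) + 2) / 4 = ((1 - Real.sin q ^ 2 : ℝ) : ℂ) := by
      rw [h2]
      push_cast
      ring
    rw [h3, Complex.norm_real, Real.norm_eq_abs, abs_of_nonneg]
    linarith [Real.sin_sq_le_one q]
  obtain ⟨ζ, g, hg⟩ := exists_symmetrizedRudvalis_eigenfunction hn6 hqpos hqn hqs hroot hK
  have hq1 : q ≤ 1 / 2 := by nlinarith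
  have hpi3 := Real.pi_gt_three
  refine ⟨_, _, g, _, ?_, hg, ?_, ?_⟩
  · unfold symmetrizedRudvalisStep
    congr 1
    funext j
    fin_cases j <;> rfl
  · rw [hlnorm, sub_sub_cancel]
    have h2 := Real.mul_le_sin hqpos.le (by linarith)
    have h3 := pow_le_pow_left₀ (by positivity) h2 2
    refine le_trans ?_ h3
    have e : (2 / Real.pi * q) ^ 2 = s / Real.pi ^ 2 / (n : ℝ) ^ 3 := by
      rw [mul_pow, hqsq]
      ring
    rw [e]
    gcongr
  · rw [hlnorm, sub_sub_cancel]
    have h2 : Real.sin q ^ 2 ≤ q ^ 2 :=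
      pow_le_pow_left₀ (Real.sin_nonneg_of_nonneg_of_le_pi hqpos.le (by linarith))
        (Real.sin_le hqpos.le) 2
    refine h2.trans ?_
    rw [hqsq]
    gcongr

end SymmetrizedRudvalis

/-! ### The three lower bounds -/

theorem theorem1 (ε : ℝ) (hε : 0 < ε) :
    (∃ δ : ℕ → ℝ, Filter.Tendsto δ Filter.atTop (nhds 0) ∧
      ∀ (n : ℕ) (hn : 2 ≤ n) (x : Deck n) (t : ℕ),
        (t : ℝ) ≤ (1 - δ n) / (8 * Real.pi ^ 2) * (n : ℝ) ^ 3 * Real.log n →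
          1 - ε ≤ tvDist (lawAfter (rudvalisStep hn) x t) (PMF.uniformOfFintype (Deck n))) ∧
    (∃ δ : ℕ → ℝ, Filter.Tendsto δ Filter.atTop (nhds 0) ∧
      ∀ (n : ℕ) (hn : 2 ≤ n) (x : Deck n) (t : ℕ),
        (t : ℝ) ≤ (1 - δ n) / (2 * Real.pi ^ 2) * (n : ℝ) ^ 3 * Real.log n →
          1 - ε ≤ tvDist (lawAfter (shiftOrSwapStep hn) x t) (PMF.uniformOfFintype (Deck n))) ∧
    (∃ δ : ℕ → ℝ, Filter.Tendsto δ Filter.atTop (nhds 0) ∧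
      ∀ (n : ℕ) (hn : 2 ≤ n) (x : Deck n) (t : ℕ),
        (t : ℝ) ≤ (1 - δ n) / Real.pi ^ 2 * (n : ℝ) ^ 3 * Real.log n →
          1 - ε ≤ tvDist (lawAfter (symmetrizedRudvalisStep hn) x t)
            (PMF.uniformOfFintype (Deck n))) := by
  have hpi : 0 < Real.pi ^ 2 := by positivity
  refine ⟨?_, ?_, ?_⟩
  · have h := exists_le_tvDist_of_positionEigenfunction (k := 2) (fun n hn => rudvalisStep hn)
      (s := 4 * Real.pi ^ 2) (by positivity) (fun η hη => ?_) ε hε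
    · rwa [show 2 * (4 * Real.pi ^ 2) = 8 * Real.pi ^ 2 by ring] at h
    · exact ⟨_, 2 * Real.pi ^ 2, by positivity, eventually_exists_rudvalis_eigenfunction
        (by positivity) (by linarith) (by nlinarith)⟩
  · refine exists_le_tvDist_of_positionEigenfunction (k := 2) (fun n hn => shiftOrSwapStep hn)
      (s := Real.pi ^ 2) hpi (fun η hη => ?_) ε hε
    have h := eventually_exists_shiftOrSwap_eigenfunction (s₀ := Real.pi ^ 2)
      (s₁ := 2 * ((1 + η) * Real.pi ^ 2)) hpi (by linarith) (by nlinarith)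
    rw [mul_div_cancel_left₀ _ two_ne_zero] at h
    exact ⟨_, Real.pi ^ 2 / 2, by positivity, h⟩
  · have h := exists_le_tvDist_of_positionEigenfunction (k := 4)
      (fun n hn => symmetrizedRudvalisStep hn) (s := Real.pi ^ 2 / 2) (by positivity)
      (fun η hη => ?_) ε hε
    · rwa [mul_div_cancel₀ _ two_ne_zero] at h
    · obtain ⟨K, h⟩ := eventually_exists_symmetrizedRudvalis_eigenfunction (s₀ := Real.pi ^ 2)
        (s₁ := 4 * ((1 + η) * (Real.pi ^ 2 / 2))) hpi (by linarith) (by nlinarith)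
      rw [mul_div_cancel_left₀ _ four_ne_zero] at h
      exact ⟨K, Real.pi ^ 2 / Real.pi ^ 2, by positivity, h⟩
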